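/- **Conventions.** All algebras are over $\mathbb{R}$ and bigraded by $\mathbb{Z}\times\mathbb{Z}_2$, with sign rule $xy=(-1)^{n_xn_y+\sigma_x\sigma_y}yx$. A super-$L_\infty$ algebra $\mathfrak{g}$ is given by its Chevalley--Eilenberg algebra $\mathrm{CE}(\mathfrak{g})$: a free graded-commutative superalgebra with a differential $\mathrm{d}$ (a graded derivation of bidegree $(1,\mathrm{evn})$, $\mathrm{d}^2=0$). A homomorphism $\mathfrak{g}\to\mathfrak{h}$ is a homomorphism $\mathrm{CE}(\mathfrak{h})\to\mathrm{CE}(\mathfrak{g})$ of differential bigraded algebras. Let $\Gamma_0,\dots,\Gamma_{10}$ be the Clifford generators of the real $32$-dimensional (Majorana) representation, $\Gamma_a\Gamma_b+\Gamma_b\Gamma_a=2\eta_{ab}$ with $\eta=\mathrm{diag}(-1,1,\dots,1)$ and $\Gamma_0\cdots\Gamma_{10}=1$, with the non-degenerate skew-symmetric spinor pairing for which the $\Gamma_a$ are skew self-adjoint; $\Gamma_{a_1\cdots a_k}$ denotes the skew-symmetrized product. Repeated indices are summed. Super-Minkowski spacetime $\mathbb{R}^{1,10|\mathbf{32}}$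 has generators $\psi^\alpha$ of bidegree $(1,\mathrm{odd})$ and $e^a$ of bidegree $(1,\mathrm{evn})$, with $\mathrm{d}\psi^\alpha=0$, $\mathrm{d}e^a=(\overline\psi\Gamma^a\psi)$. Put $$G_4=\tfrac12(\overline\psi\Gamma_{ab}\psi)e^ae^b,\qquad G_7=\tfrac1{5!}(\overline\psi\Gamma_{a_1\cdots a_5}\psi)e^{a_1}\cdots e^{a_5}.$$ Let $\mathfrak{m}2\mathfrak{brane}$ and $\mathfrak{m}2\mathfrak{brane}^-$ be the extensions of $\mathbb{R}^{1,10|\mathbf{32}}$ by one further generator $c_3$, resp. $c_3^-$, of bidegree $(3,\mathrm{evn})$ with $\mathrm{d}c_3=G_4$, resp. $\mathrm{d}c_3^-=-G_4$. Every element of either CE-algebra is uniquely $\alpha=\alpha_{\mathrm{bas}}+c\cdot p_*\alpha$ with $c=c_3$ resp. $c_3^-$ and $\alpha_{\mathrm{bas}},p_*\alpha\in\mathrm{CE}(\mathbb{R}^{1,10|\mathbf{32}})$. Put $$\widetilde G_7=2G_7-c_3G_4,\qquad \widetilde G_7^-=2G_7+c_3^-G_4 .$$ For a $7$-cocycle $H$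 on $\mathfrak{g}$ and $m\in\mathbb{Z}$, an $H$-twisted cocycle of degree $m$ mod $6$ is a homomorphism from $\mathfrak{g}$ to the algebra $\mathfrak{l}(m)$ with generators $h_7$ of bidegree $(7,\mathrm{evn})$ and $f_{6k+m}$ of bidegree $(6k+m,\mathrm{evn})$ ($k\in\mathbb{Z}$), $\mathrm{d}h_7=0$, $\mathrm{d}f_{6(k+1)+m}=h_7f_{6k+m}$, sending $h_7\mapsto H$; equivalently a family $(F_{6k+m})_{k\in\mathbb{Z}}$ with $F_{6k+m}\in\mathrm{CE}(\mathfrak{g})$ of bidegree $(6k+m,\mathrm{evn})$ and $\mathrm{d}F_{6(k+1)+m}=H\,F_{6k+m}$. The $3$-cyclification $\mathrm{cyc}_3(\mathfrak{h})$ of an algebra $\mathfrak{h}$ with generators $e^i$ has generators $\omega_4$ of bidegree $(4,\mathrm{evn})$, $e^i$, and $\mathrm{s}e^i$ of bidegree $\deg e^i-(3,\mathrm{evn})$, with $\mathrm{d}\omega_4=0$, $\mathrm{d}e^i=\mathrm{d}_{\mathfrak{h}}e^i+\omega_4\,\mathrm{s}e^i$, $\mathrm{d}\,\mathrm{s}e^i=-\mathrm{s}(\mathrm{d}_{\mathfrak{h}}e^i)$,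 where $\mathrm{s}$ is the graded derivation with $e^i\mapsto\mathrm{s}e^i$, $\mathrm{s}e^i\mapsto0$, $\omega_4\mapsto 0$. The reduction of a homomorphism $f:\widehat{\mathfrak{g}}\to\mathfrak{h}$ from the extension of $\mathfrak{g}$ by a $4$-cocycle $\omega$ is the homomorphism $\mathfrak{g}\to\mathrm{cyc}_3(\mathfrak{h})$ with $\omega_4\mapsto\omega$, $e^i\mapsto(f^*e^i)_{\mathrm{bas}}$, $\mathrm{s}e^i\mapsto-p_*f^*e^i$; the inverse operation is oxidation along $\omega$. *Higher T-duality* is the composite of reduction along the first extension, precomposition of the pullback with the map $\omega_4\mapsto-\mathrm{s}h_7$, $\mathrm{s}h_7\mapsto-\omega_4$, $h_7\mapsto h_7$ (for twists, on $\mathrm{CE}(\mathrm{cyc}_3(b^6\mathbb{R}))$, where $b^6\mathbb{R}$ has one closed generator $h_7$), extended by $f_{6k-3+m}\mapsto\mathrm{s}f_{6k+m}$, $\mathrm{s}f_{6k-3+m}\mapsto f_{6(k-1)+m}$ (for twisted cocycles, $\mathrm{CE}(\mathrm{cyc}_3\,\mathfrak{l}(m-3))\to\mathrm{CE}(\mathrm{cyc}_3\,\mathfrak{l}(m))$),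 and oxidation along the second extension. **Statement.** 1. $\mathfrak{m}2\mathfrak{brane}$ and $\mathfrak{m}2\mathfrak{brane}^-$ are super-$L_\infty$ algebras ($\mathrm{d}^2=0$); $\widetilde G_7$ and $\widetilde G_7^-$ are $7$-cocycles on them, and each is carried to the other by higher T-duality. The reflection $c_3^-\mapsto-c_3$ (identity on $\psi^\alpha$, $e^a$) defines an isomorphism $\mathfrak{m}2\mathfrak{brane}\cong\mathfrak{m}2\mathfrak{brane}^-$ whose pullback sends $\widetilde G_7^-$ to $\widetilde G_7$. 2. For every $m\in\mathbb{Z}$, higher T-duality is a bijection from $\widetilde G_7$-twisted cocycles of degree $m$ mod $6$ on $\mathfrak{m}2\mathfrak{brane}$ to $\widetilde G_7^-$-twisted cocycles of degree $m-3$ mod $6$ on $\mathfrak{m}2\mathfrak{brane}^-$, explicitly $$(F_{6k+m})_{k}\longmapsto(F'_{6k-3+m})_k,\qquad F'_{6k-3+m}=-p_*F_{6k+m}-c_3^-\,(F_{6(k-1)+m})_{\mathrm{bas}},$$ with inverse $F_{6k+m}=-p_*F'_{6(k+1)-3+m}-c_3\,(F'_{6k-3+m})_{\mathrm{bas}}$.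 Likewise, with the roles of $(\mathfrak{m}2\mathfrak{brane},\widetilde G_7,c_3)$ and $(\mathfrak{m}2\mathfrak{brane}^-,\widetilde G_7^-,c_3^-)$ exchanged. 3. Composing with the pullback along the reflection gives, for every $m$, a bijection from $\widetilde G_7$-twisted cocycles of degree $m$ mod $6$ on $\mathfrak{m}2\mathfrak{brane}$ to those of degree $m-3$ mod $6$ on $\mathfrak{m}2\mathfrak{brane}$, $$(F_{6k+m})_k\longmapsto\big(-p_*F_{6k+m}+c_3\,(F_{6(k-1)+m})_{\mathrm{bas}}\big)_k ,$$ and it is non-trivial: for some twisted cocycle $F$ of degree $m$ mod $6$, some component of its image is not a real multiple of any component of $F$. The same holds for $\widetilde G_7^-$-twisted cocycles on $\mathfrak{m}2\mathfrak{brane}^-$, with $c_3^-$ in place of $c_3$. -/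

import Mathlib

open scoped Kronecker

noncomputable section

namespace SuperLInfty

/-! ## Free graded-commutative superalgebras -/

/-- Bidegrees `(n, σ)`: homological degree and super-degree (`evn = 0`, `odd = 1`). -/
abbrev BiDeg : Type := ℤ × ZMod 2

/-- The sign `(-1)^(n₁ n₂ + σ₁ σ₂)` picked up when exchanging elements of bidegrees
`(n₁, σ₁)` and `(n₂, σ₂)`. -/
def koszul (a b : BiDeg) : ℝ :=
  (((a.1 * b.1 + ((a.2 * b.2).val : ℤ)).negOnePow : ℤˣ) : ℤ)

/-- The sign `(-1)^n` of a bidegree `(n, σ)`. -/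
def parity (a : BiDeg) : ℝ := ((a.1.negOnePow : ℤˣ) : ℤ)

/-- The relations `v_i v_j = koszul(deg_i, deg_j) v_j v_i` on the tensor algebra. -/
inductive GCA.Rel {I : Type} (deg : I → BiDeg) : FreeAlgebra ℝ I → FreeAlgebra ℝ I → Prop
  | comm (i j : I) : GCA.Rel deg (FreeAlgebra.ι ℝ i * FreeAlgebra.ι ℝ j)
      (koszul (deg i) (deg j) • (FreeAlgebra.ι ℝ j * FreeAlgebra.ι ℝ i))

/-- The graded-commutative polynomial algebra `ℝ[(v_i)_{i ∈ I}]` on generators of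
bidegrees `deg i`. -/
def GCA {I : Type} (deg : I → BiDeg) : Type := RingQuot (GCA.Rel deg)

instance {I : Type} (deg : I → BiDeg) : Ring (GCA deg) :=
  inferInstanceAs (Ring (RingQuot (GCA.Rel deg)))

instance {I : Type} (deg : I → BiDeg) : Algebra ℝ (GCA deg) :=
  inferInstanceAs (Algebra ℝ (RingQuot (GCA.Rel deg)))

namespace GCA

variable {I J : Type} {deg : I → BiDeg} {deg' : J → BiDeg}

/-- The quotient map from the tensor algebra. -/
def mk (deg : I → BiDeg) : FreeAlgebra ℝ I →ₐ[ℝ] GCA deg := RingQuot.mkAlgHom ℝ (Rel deg)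

/-- The generators. -/
def gen (deg : I → BiDeg) (i : I) : GCA deg := mk deg (FreeAlgebra.ι ℝ i)

/-- The algebra map determined by the images of the generators. -/
def lift {B : Type} [Ring B] [Algebra ℝ B] (f : I → B)
    (hf : ∀ i j, f i * f j = koszul (deg i) (deg j) • (f j * f i)) : GCA deg →ₐ[ℝ] B :=
  RingQuot.liftAlgHom ℝ ⟨FreeAlgebra.lift ℝ f, by
    rintro _ _ ⟨i, j⟩
    simpa using hf i j⟩

@[simp] theorem lift_gen {B : Type} [Ring B] [Algebra ℝ B] (f : I → B)
    (hf : ∀ i j, f i * f j = koszul (deg i) (deg j) • (f j * f i)) (i : I) :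
    lift f hf (gen deg i) = f i :=
  (RingQuot.liftAlgHom_mkAlgHom_apply ℝ _ _ _).trans (FreeAlgebra.lift_ι_apply f i)

/-- The subspace of elements of bidegree `a`: the span of the monomials in the generators of
total bidegree `a`. -/
def homog (deg : I → BiDeg) (a : BiDeg) : Submodule ℝ (GCA deg) :=
  Submodule.span ℝ {x | ∃ l : List I, (l.map deg).sum = a ∧ x = (l.map (gen deg)).prod}

theorem koszul_add_left (a b c : BiDeg) : koszul (a + b) c = koszul a c * koszul b c := by
  obtain ⟨a, s⟩ := a
  obtain ⟨b, t⟩ := b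
  obtain ⟨c, u⟩ := c
  simp only [koszul, Prod.mk_add_mk]
  rw [← Int.cast_mul, ← Units.val_mul, ← Int.negOnePow_add]
  congr 2
  rw [Int.negOnePow_eq_iff]
  have h : Even ((((s + t) * u).val : ℤ) - ((s * u).val + (t * u).val)) := by
    revert s t u; decide
  have e : (a + b) * c + (((s + t) * u).val : ℤ)
      - (a * c + ((s * u).val : ℤ) + (b * c + ((t * u).val : ℤ)))
      = (((s + t) * u).val : ℤ) - ((s * u).val + (t * u).val) := by ring
  rw [e]; exact h

theorem koszul_symm (a b : BiDeg) : koszul a b = koszul b a := by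
  simp only [koszul, mul_comm]

theorem koszul_add_right (a b c : BiDeg) : koszul a (b + c) = koszul a b * koszul a c := by
  rw [koszul_symm, koszul_add_left, koszul_symm b, koszul_symm c]

theorem koszul_zero_left (a : BiDeg) : koszul 0 a = 1 := by simp [koszul]

theorem koszul_zero_right (a : BiDeg) : koszul a 0 = 1 := by simp [koszul]

theorem koszul_mul_self (a b : BiDeg) : koszul a b * koszul a b = 1 := by
  simp only [koszul]
  rw [← Int.cast_mul, ← Units.val_mul, Int.units_mul_self]; simp

theorem koszul_odd (a : BiDeg) {k : ℤ} (hk : Odd k) : koszul a (k, 0) = parity a := by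
  simp only [koszul, parity, mul_zero, ZMod.val_zero, Nat.cast_zero, add_zero]
  congr 2
  rw [Int.negOnePow_eq_iff]
  have : a.1 * k - a.1 = a.1 * (k - 1) := by ring
  rw [this]
  exact (hk.sub_odd odd_one).mul_left _

theorem parity_mul_self (a : BiDeg) : parity a * parity a = 1 := by
  rw [← koszul_odd a odd_one, koszul_mul_self]

theorem gen_mul_gen (i j : I) :
    gen deg i * gen deg j = koszul (deg i) (deg j) • (gen deg j * gen deg i) := by
  have h : mk deg (FreeAlgebra.ι ℝ i * FreeAlgebra.ι ℝ j)
      = mk deg (koszul (deg i) (deg j) • (FreeAlgebra.ι ℝ j * FreeAlgebra.ι ℝ i)) :=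
    RingQuot.mkAlgHom_rel ℝ (Rel.comm (deg := deg) i j)
  rwa [map_smul, map_mul, map_mul] at h

theorem gen_mem (i : I) : gen deg i ∈ homog deg (deg i) :=
  Submodule.subset_span ⟨[i], by simp, by simp⟩

theorem one_homog : (1 : GCA deg) ∈ homog deg 0 :=
  Submodule.subset_span ⟨[], by simp, by simp⟩

theorem mul_homog {a b : BiDeg} {x y : GCA deg} (hx : x ∈ homog deg a) (hy : y ∈ homog deg b) :
    x * y ∈ homog deg (a + b) := by
  induction hx using Submodule.span_induction with
  | mem x hx =>
    obtain ⟨l, rfl, rfl⟩ := hx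
    induction hy using Submodule.span_induction with
    | mem y hy =>
      obtain ⟨l', rfl, rfl⟩ := hy
      exact Submodule.subset_span ⟨l ++ l', by simp, by simp⟩
    | zero => simp
    | add y z _ _ h1 h2 => rw [mul_add]; exact add_mem h1 h2
    | smul r y _ h => rw [mul_smul_comm]; exact Submodule.smul_mem _ _ h
  | zero => simp
  | add y z _ _ h1 h2 => rw [add_mul]; exact add_mem h1 h2
  | smul r y _ h => rw [smul_mul_assoc]; exact Submodule.smul_mem _ _ h

theorem gen_mul_mono (i : I) (l : List I) :
    gen deg i * (l.map (gen deg)).prod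
      = koszul (deg i) (l.map deg).sum • ((l.map (gen deg)).prod * gen deg i) := by
  induction l with
  | nil => simp [koszul_zero_right]
  | cons j l ih =>
    simp only [List.map_cons, List.prod_cons, List.sum_cons, koszul_add_right]
    rw [← mul_assoc, gen_mul_gen, smul_mul_assoc, mul_assoc, ih, mul_smul_comm, smul_smul,
      mul_assoc]

theorem mono_mul_mono (l l' : List I) :
    (l.map (gen deg)).prod * (l'.map (gen deg)).prod
      = koszul (l.map deg).sum (l'.map deg).sum •
        ((l'.map (gen deg)).prod * (l.map (gen deg)).prod) := by
  induction l with
  | nil => simp [koszul_zero_left]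
  | cons i l ih =>
    simp only [List.map_cons, List.prod_cons, List.sum_cons, koszul_add_left]
    rw [mul_assoc, ih, mul_smul_comm, ← mul_assoc, gen_mul_mono, smul_mul_assoc, smul_smul,
      mul_assoc, mul_comm (koszul _ _)]

/-- Homogeneous elements commute up to the Koszul sign. -/
theorem homog_comm {a b : BiDeg} {x y : GCA deg} (hx : x ∈ homog deg a)
    (hy : y ∈ homog deg b) : x * y = koszul a b • (y * x) := by
  induction hx using Submodule.span_induction with
  | mem x hx =>
    obtain ⟨l, rfl, rfl⟩ := hx
    induction hy using Submodule.span_induction with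
    | mem y hy =>
      obtain ⟨l', rfl, rfl⟩ := hy
      exact mono_mul_mono l l'
    | zero => simp
    | add y z _ _ h1 h2 => rw [mul_add, h1, h2, add_mul, smul_add]
    | smul r y _ h => rw [mul_smul_comm, h, smul_mul_assoc, smul_comm]
  | zero => simp
  | add y z _ _ h1 h2 => rw [add_mul, h1, h2, mul_add, smul_add]
  | smul r y _ h => rw [smul_mul_assoc, h, mul_smul_comm, smul_comm]

/-- The algebra map sending the generators to given elements of the same bidegree. -/
def map (f : I → GCA deg') (hf : ∀ i, f i ∈ homog deg' (deg i)) : GCA deg →ₐ[ℝ] GCA deg' :=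
  lift f fun i j => homog_comm (hf i) (hf j)

@[simp] theorem map_gen (f : I → GCA deg') (hf : ∀ i, f i ∈ homog deg' (deg i)) (i : I) :
    map f hf (gen deg i) = f i := lift_gen _ _ i

theorem algHom_mem (φ : GCA deg →ₐ[ℝ] GCA deg')
    (h : ∀ i, φ (gen deg i) ∈ homog deg' (deg i)) {a : BiDeg} {x : GCA deg}
    (hx : x ∈ homog deg a) : φ x ∈ homog deg' a := by
  induction hx using Submodule.span_induction with
  | mem x hx =>
    obtain ⟨l, rfl, rfl⟩ := hx
    induction l with
    | nil => simpa using one_homog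
    | cons i l ih => simpa using mul_homog (h i) ih
  | zero => simp
  | add y z _ _ h1 h2 => rw [map_add]; exact add_mem h1 h2
  | smul r y _ h => rw [map_smul]; exact Submodule.smul_mem _ _ h

theorem map_mem (f : I → GCA deg') (hf : ∀ i, f i ∈ homog deg' (deg i)) {a : BiDeg}
    {x : GCA deg} (hx : x ∈ homog deg a) : map f hf x ∈ homog deg' a :=
  algHom_mem _ (fun i => by rw [map_gen]; exact hf i) hx

theorem induction {C : GCA deg → Prop} (algebraMap : ∀ r : ℝ, C (algebraMap ℝ _ r))
    (gen : ∀ i, C (gen deg i)) (mul : ∀ x y, C x → C y → C (x * y))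
    (add : ∀ x y, C x → C y → C (x + y)) (x : GCA deg) : C x := by
  obtain ⟨y, rfl⟩ : ∃ y, mk deg y = x := RingQuot.mkAlgHom_surjective ℝ (Rel deg) x
  induction y using FreeAlgebra.induction with
  | grade0 r => simpa using algebraMap r
  | grade1 i => exact gen i
  | mul a b ha hb => rw [map_mul]; exact mul _ _ ha hb
  | add a b ha hb => rw [map_add]; exact add _ _ ha hb

/-- The grading involution `x ↦ (-1)^n x` for `x` of bidegree `(n, σ)`. -/
def invol (deg : I → BiDeg) : GCA deg →ₐ[ℝ] GCA deg :=
  map (fun i => parity (deg i) • gen deg i) fun i => Submodule.smul_mem _ _ (gen_mem i)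

@[simp] theorem invol_gen (i : I) : invol deg (gen deg i) = parity (deg i) • gen deg i := by
  simp [invol]

/-! ### Odd graded derivations

Let `φ = map f hf` be the algebra map with values `f i` on generators, and `v i` elements of
bidegree `deg i + (k, evn)` with `k` odd. The graded derivation `D` of degree `(k, evn)` along `φ`
with `D (gen i) = v i`, i.e. `D (x y) = D x · φ y + (-1)^|x| φ x · D y`, is the upper right
corner of the algebra map `x ↦ !![φ ((-1)^|x| x), D x; 0, φ x]`. -/

section OddDer

variable (f : I → GCA deg') (hf : ∀ i, f i ∈ homog deg' (deg i)) (k : ℤ) (hk : Odd k)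
  (v : I → GCA deg') (hv : ∀ i, v i ∈ homog deg' (deg i + (k, 0)))

/-- The algebra map into upper triangular matrices encoding an odd derivation. -/
def oddDerMat : GCA deg →ₐ[ℝ] Matrix (Fin 2) (Fin 2) (GCA deg') :=
  lift (fun i => !![parity (deg i) • f i, v i; 0, f i]) fun i j => by
    have h1 := homog_comm (hf i) (hf j)
    have h2 := homog_comm (hf i) (hv j)
    have h3 := homog_comm (hv i) (hf j)
    rw [koszul_add_right, koszul_odd _ hk] at h2
    rw [koszul_add_left, koszul_symm (k, 0), koszul_odd _ hk] at h3
    have pi := parity_mul_self (deg i)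
    ext a b
    fin_cases a <;> fin_cases b
    · simp [Matrix.mul_apply, h1, smul_smul]
      ring_nf
    · have e : parity (deg i) * (koszul (deg i) (deg j) * parity (deg i))
          = koszul (deg i) (deg j) := by
        rw [mul_left_comm, pi, mul_one]
      simp [Matrix.mul_apply, h2, h3, smul_smul, e, smul_add, add_comm]
    · simp [Matrix.mul_apply]
    · simp [Matrix.mul_apply, h1]

/-- The odd derivation `D`. -/
def oddDer : GCA deg →ₗ[ℝ] GCA deg' where
  toFun x := oddDerMat f hf k hk v hv x 0 1
  map_add' x y := by simp
  map_smul' r x := by simp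

@[simp] theorem oddDer_gen (i : I) : oddDer f hf k hk v hv (gen deg i) = v i := by
  simp [oddDer, oddDerMat]

theorem oddDerMat_apply (x : GCA deg) :
    oddDerMat f hf k hk v hv x =
      !![map f hf (invol deg x), oddDer f hf k hk v hv x; 0, map f hf x] := by
  have key : oddDerMat f hf k hk v hv x 0 0 = map f hf (invol deg x) ∧
      oddDerMat f hf k hk v hv x 1 0 = 0 ∧ oddDerMat f hf k hk v hv x 1 1 = map f hf x := by
    induction x using GCA.induction with
    | algebraMap r => simp [Matrix.algebraMap_eq_diagonal, AlgHom.commutes]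
    | gen i => simp [oddDerMat, invol]
    | mul x y hx hy =>
      simp [Matrix.mul_apply, hx.1, hx.2.1, hx.2.2, hy.1, hy.2.1, hy.2.2]
    | add x y hx hy =>
      simp [hx.1, hx.2.1, hx.2.2, hy.1, hy.2.1, hy.2.2]
  ext a b
  fin_cases a <;> fin_cases b
  · exact key.1
  · rfl
  · exact key.2.1
  · exact key.2.2

/-- The graded Leibniz rule. -/
theorem oddDer_mul (x y : GCA deg) :
    oddDer f hf k hk v hv (x * y) =
      oddDer f hf k hk v hv x * map f hf y + map f hf (invol deg x) * oddDer f hf k hk v hv y := by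
  have h : oddDer f hf k hk v hv (x * y) = oddDerMat f hf k hk v hv (x * y) 0 1 := rfl
  rw [h, map_mul, oddDerMat_apply, oddDerMat_apply]
  simp [Matrix.mul_apply, add_comm]

theorem invol_of_mem {a : BiDeg} {x : GCA deg} (hx : x ∈ homog deg a) :
    invol deg x = parity a • x := by
  induction hx using Submodule.span_induction with
  | mem x hx =>
    obtain ⟨l, rfl, rfl⟩ := hx
    induction l with
    | nil => simp [parity]
    | cons i l ih =>
      have : parity (deg i + (l.map deg).sum) = parity (deg i) * parity (l.map deg).sum := by
        rw [← koszul_odd _ odd_one, ← koszul_odd _ odd_one, ← koszul_odd _ odd_one,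
          koszul_add_left]
      simp only [List.map_cons, List.prod_cons, List.sum_cons, map_mul, ih, this, invol_gen,
        smul_mul_assoc, mul_smul_comm, smul_smul, mul_comm (parity (List.map deg l).sum)]
  | zero => simp
  | add y z _ _ h1 h2 => rw [map_add, h1, h2, smul_add]
  | smul r y _ h => rw [map_smul, h, smul_comm]

theorem oddDer_one : oddDer f hf k hk v hv 1 = 0 := by
  have h : oddDer f hf k hk v hv 1 = oddDerMat f hf k hk v hv 1 0 1 := rfl
  simp [h]

theorem oddDer_mem {a : BiDeg} {x : GCA deg} (hx : x ∈ homog deg a) :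
    oddDer f hf k hk v hv x ∈ homog deg' (a + (k, 0)) := by
  induction hx using Submodule.span_induction with
  | mem x hx =>
    obtain ⟨l, rfl, rfl⟩ := hx
    induction l with
    | nil => simp [oddDer_one]
    | cons i l ih =>
      have hl : (l.map (gen deg)).prod ∈ homog deg (l.map deg).sum :=
        Submodule.subset_span ⟨l, rfl, rfl⟩
      simp only [List.map_cons, List.prod_cons, List.sum_cons, oddDer_mul, oddDer_gen]
      refine add_mem ?_ ?_
      · rw [add_right_comm]
        exact mul_homog (hv i) (map_mem f hf hl)
      · rw [add_assoc, invol_of_mem (gen_mem i), map_smul, smul_mul_assoc, map_gen]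
        exact Submodule.smul_mem _ _ (mul_homog (hf i) ih)
  | zero => simp
  | add y z _ _ h1 h2 => rw [map_add]; exact add_mem h1 h2
  | smul r y _ h => rw [map_smul]; exact Submodule.smul_mem _ _ h

end OddDer

end GCA

open GCA

/-! ## Super-`L_∞` algebras through their Chevalley–Eilenberg algebras -/

/-- A presentation `ℝ_d[(t^i)_i] / (d t^i = P^i)`: bigraded generators with prescribed
differentials `P^i` of bidegree `deg i + (1, evn)`. It is the Chevalley–Eilenberg algebra of a
super-`L_∞` algebra if the resulting derivation squares to zero, see `IsSuperLInfty`. -/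
structure Presentation where
  /-- the generators `t^i` -/
  Gen : Type
  /-- their bidegrees -/
  deg : Gen → BiDeg
  /-- their differentials `P^i` -/
  diff : Gen → GCA deg
  diff_mem : ∀ i, diff i ∈ homog deg (deg i + (1, 0))

namespace Presentation

/-- The underlying graded-commutative superalgebra of the Chevalley–Eilenberg algebra. -/
abbrev CE (g : Presentation) : Type := GCA g.deg

/-- The generators, as elements of the Chevalley–Eilenberg algebra. -/
abbrev gen (g : Presentation) (i : g.Gen) : g.CE := GCA.gen g.deg i

/-- The elements of bidegree `a`. -/
abbrev homog (g : Presentation) (a : BiDeg) : Submodule ℝ g.CE := GCA.homog g.deg a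

/-- The differential: the graded derivation of degree `(1, evn)` with `d t^i = P^i`. -/
def d (g : Presentation) : g.CE →ₗ[ℝ] g.CE :=
  oddDer (GCA.gen g.deg) gen_mem 1 odd_one g.diff g.diff_mem

/-- The consistency condition `d ∘ d = 0`. -/
def IsSuperLInfty (g : Presentation) : Prop := ∀ x : g.CE, g.d (g.d x) = 0

/-- Homomorphisms `g → h` of super-`L_∞` algebras: homomorphisms `CE(h) → CE(g)` of
differential bigraded algebras. -/
structure Hom (g h : Presentation) where
  /-- the pullback `CE(h) → CE(g)` -/
  pull : h.CE →ₐ[ℝ] g.CE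
  pull_mem : ∀ (a : BiDeg) (x : h.CE), x ∈ h.homog a → pull x ∈ g.homog a
  pull_d : ∀ x : h.CE, pull (h.d x) = g.d (pull x)

/-! ### Higher central extensions by even cocycles -/

section Ext

variable (g : Presentation) (t : ℤ) (ω : g.CE) (hω : ω ∈ g.homog (2 * t, 0))

/-- Bidegrees of the generators of the extension: the new generator `none` has bidegree
`(2t - 1, evn)`. -/
def extDeg : Option g.Gen → BiDeg
  | none => (2 * t - 1, 0)
  | some i => g.deg i

/-- The inclusion `p^* : CE(g) → CE(ĝ)` of basic elements. -/
def basicIncl : g.CE →ₐ[ℝ] GCA (extDeg g t) :=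
  GCA.map (deg := g.deg) (fun i => GCA.gen (extDeg g t) (some i)) fun i => gen_mem (deg := extDeg g t) (some i)

@[simp] theorem basicIncl_gen (i : g.Gen) :
    basicIncl g t (g.gen i) = GCA.gen (extDeg g t) (some i) := map_gen _ _ i

theorem basicIncl_mem {a : BiDeg} {x : g.CE} (hx : x ∈ g.homog a) :
    basicIncl g t x ∈ GCA.homog (extDeg g t) a := GCA.map_mem _ _ hx

/-- The values on generators of the projection onto the basic part. -/
def basVal : Option g.Gen → g.CE
  | none => 0
  | some i => g.gen i

theorem basVal_mem : ∀ i, basVal g i ∈ g.homog (extDeg g t i)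
  | none => zero_mem _
  | some i => gen_mem i

/-- The values on generators of fiber integration. -/
def fibVal : Option g.Gen → g.CE
  | none => 1
  | some _ => 0

theorem fibVal_mem : ∀ i, fibVal g i ∈ g.homog (extDeg g t i + (-(2 * t - 1), 0))
  | none => by
    have e : extDeg g t none + (-(2 * t - 1), 0) = 0 := by simp [extDeg]
    rw [e]
    exact one_homog
  | some i => zero_mem _

theorem odd_aux : Odd (-(2 * t - 1)) := ⟨-t, by ring⟩

/-- The basic part `α_bas ∈ CE(g)` of `α ∈ CE(ĝ)`. -/
def basicPart : GCA (extDeg g t) →ₐ[ℝ] g.CE :=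
  GCA.map (basVal g) (basVal_mem g t)

/-- Fiber integration `p_* : CE(ĝ) → CE(g)`: the graded derivation of degree
`(-(2t - 1), evn)` with `b ↦ 1` and vanishing on the generators of `CE(g)`. -/
def fiberInt : GCA (extDeg g t) →ₗ[ℝ] g.CE :=
  oddDer (basVal g) (basVal_mem g t) (-(2 * t - 1)) (odd_aux t) (fibVal g) (fibVal_mem g t)

theorem fiberInt_mul (x y : GCA (extDeg g t)) :
    fiberInt g t (x * y) = fiberInt g t x * basicPart g t y
      + basicPart g t (invol _ x) * fiberInt g t y :=
  oddDer_mul _ _ _ _ _ _ x y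

theorem basicIncl_mul_gen (x : g.CE) :
    basicIncl g t x * GCA.gen (extDeg g t) none
      = GCA.gen (extDeg g t) none * basicIncl g t (invol g.deg x) := by
  induction x using GCA.induction with
  | algebraMap r => simp only [AlgHom.commutes, Algebra.commutes]
  | gen i =>
    have h := gen_mul_gen (deg := extDeg g t) (some i) none
    have e : koszul (extDeg g t (some i)) (extDeg g t none) = parity (g.deg i) :=
      koszul_odd (g.deg i) (k := 2 * t - 1) ⟨t - 1, by ring⟩
    rw [e] at h
    simpa using h
  | mul x y hx hy =>
    rw [map_mul, mul_assoc, hy, ← mul_assoc, hx, map_mul, map_mul, mul_assoc]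
  | add x y hx hy => rw [map_add, add_mul, hx, hy, map_add, map_add, mul_add]

theorem gen_none_sq : GCA.gen (extDeg g t) none * GCA.gen (extDeg g t) none = 0 := by
  have h := gen_mul_gen (deg := extDeg g t) none none
  have e : koszul (extDeg g t none) (extDeg g t none) = -1 := by
    have h1 : koszul (extDeg g t none) (extDeg g t none) = parity (extDeg g t none) :=
      koszul_odd _ (k := 2 * t - 1) ⟨t - 1, by ring⟩
    have ho : Odd (2 * t - 1) := ⟨t - 1, by ring⟩
    rw [h1]
    simp [parity, extDeg, Int.negOnePow_odd _ ho]
  rw [e] at h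
  have h2 : (2 : ℝ) • (GCA.gen (extDeg g t) none * GCA.gen (extDeg g t) none) = 0 := by
    rw [two_smul]
    nth_rewrite 1 [h]
    module
  exact (smul_eq_zero.mp h2).resolve_left two_ne_zero

theorem basicPart_invol (x : GCA (extDeg g t)) :
    basicPart g t (invol _ x) = invol g.deg (basicPart g t x) := by
  induction x using GCA.induction with
  | algebraMap r => simp only [AlgHom.commutes]
  | gen i =>
    cases i with
    | none => simp [basicPart, basVal]
    | some i => simp [basicPart, basVal, extDeg]
  | mul x y hx hy => simp only [map_mul, hx, hy]
  | add x y hx hy => simp only [map_add, hx, hy]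

/-- The decomposition `α = α_bas + b · p_* α`. -/
theorem basic_add_fiber (α : GCA (extDeg g t)) :
    α = basicIncl g t (basicPart g t α)
      + GCA.gen (extDeg g t) none * basicIncl g t (fiberInt g t α) := by
  induction α using GCA.induction with
  | algebraMap r =>
    have h : fiberInt g t (algebraMap ℝ _ r) = 0 := by
      rw [Algebra.algebraMap_eq_smul_one, map_smul, fiberInt, oddDer_one, smul_zero]
    rw [h, AlgHom.commutes, AlgHom.commutes, map_zero, mul_zero, add_zero]
  | gen i =>
    cases i with
    | none => simp [basicPart, fiberInt, basVal, fibVal]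
    | some i => simp [basicPart, fiberInt, basVal, fibVal]
  | mul x y hx hy =>
    have hb := basicIncl_mul_gen g t
    rw [fiberInt_mul, basicPart_invol]
    conv_lhs => rw [hx, hy]
    simp only [map_mul, map_add, mul_add, add_mul]
    have hbb := gen_none_sq g t
    generalize GCA.gen (extDeg g t) none = b at *
    rw [← mul_assoc (basicIncl g t (basicPart g t x)) b, hb]
    have : b * basicIncl g t (fiberInt g t x) * (b * basicIncl g t (fiberInt g t y)) = 0 := by
      rw [mul_assoc, ← mul_assoc _ b, hb, ← mul_assoc, ← mul_assoc, hbb, zero_mul, zero_mul]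
    rw [this]
    noncomm_ring
  | add x y hx hy =>
    conv_lhs => rw [hx, hy]
    simp only [map_add, mul_add]
    abel

/-- Differentials of the generators of the extension. -/
def extDiff : Option g.Gen → GCA (extDeg g t)
  | none => basicIncl g t ω
  | some i => basicIncl g t (g.diff i)

/-- The higher central extension `ĝ` of `g` classified by the `2t`-cocycle `ω`:
`CE(ĝ) = CE(g)[b] / (d b = ω)` with `b` of bidegree `(2t - 1, evn)`. -/
abbrev ext : Presentation where
  Gen := Option g.Gen
  deg := extDeg g t
  diff := extDiff g t ω
  diff_mem
    | none => by
      have e : extDeg g t none + (1, 0) = (2 * t, 0) := by simp [extDeg]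
      rw [e]
      exact basicIncl_mem g t hω
    | some i => basicIncl_mem g t (g.diff_mem i)

/-- The inclusion `p^* : CE(g) → CE(ĝ)`. -/
abbrev extIncl : g.CE →ₐ[ℝ] (g.ext t ω hω).CE := basicIncl g t

/-- The extending generator `b`. -/
abbrev extGen : (g.ext t ω hω).CE := (g.ext t ω hω).gen none

/-- The basic part `α_bas ∈ CE(g)` of `α ∈ CE(ĝ)`. -/
abbrev bas : (g.ext t ω hω).CE →ₐ[ℝ] g.CE := basicPart g t

/-- Fiber integration `p_* : CE(ĝ) → CE(g)`. -/
abbrev fib : (g.ext t ω hω).CE →ₗ[ℝ] g.CE := fiberInt g t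

end Ext

/-! ### Higher cyclification -/

section Cyc

/-- Generators of the cyclification: `ω_{2t}`, `e^i` and `s_t e^i`. -/
inductive CycGen (I : Type) : Type
  | omega : CycGen I
  | base : I → CycGen I
  | shift : I → CycGen I

variable (h : Presentation) (t : ℤ)

/-- Bidegrees of the generators of the cyclification. -/
def cycDeg : CycGen h.Gen → BiDeg
  | .omega => (2 * t, 0)
  | .base i => h.deg i
  | .shift i => h.deg i + (-(2 * t - 1), 0)

/-- The inclusion of graded algebras `CE(h) → CE(cyc h)`, `e^i ↦ e^i` (not a chain map). -/
def cycIncl : h.CE →ₐ[ℝ] GCA (cycDeg h t) :=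
  GCA.map (deg := h.deg) (fun i => GCA.gen (cycDeg h t) (.base i))
    fun i => gen_mem (deg := cycDeg h t) (.base i)

/-- The shift derivation `s_t` of degree `(-(2t - 1), evn)`, restricted to `CE(h)`:
`e^i ↦ s_t e^i`. -/
def cycShift : h.CE →ₗ[ℝ] GCA (cycDeg h t) :=
  oddDer (deg := h.deg) (fun i => GCA.gen (cycDeg h t) (.base i))
    (fun i => gen_mem (deg := cycDeg h t) (.base i)) (-(2 * t - 1)) (odd_aux t)
    (fun i => GCA.gen (cycDeg h t) (.shift i))
    (fun i => gen_mem (deg := cycDeg h t) (.shift i))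

/-- Differentials of the generators of the cyclification. -/
def cycDiff : CycGen h.Gen → GCA (cycDeg h t)
  | .omega => 0
  | .base i => cycIncl h t (h.diff i)
      + GCA.gen (cycDeg h t) .omega * GCA.gen (cycDeg h t) (.shift i)
  | .shift i => - cycShift h t (h.diff i)

/-- The `(2t - 1)`-cyclification of `h`: `d ω = 0`, `d e^i = d_h e^i + ω · s_t e^i`,
`d (s_t e^i) = - s_t (d_h e^i)`. -/
abbrev cyc : Presentation where
  Gen := CycGen h.Gen
  deg := cycDeg h t
  diff := cycDiff h t
  diff_mem
    | .omega => zero_mem _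
    | .base i => by
      refine add_mem (GCA.map_mem _ _ (h.diff_mem i)) ?_
      have := mul_homog (gen_mem (deg := cycDeg h t) .omega)
        (gen_mem (deg := cycDeg h t) (.shift i))
      have e : cycDeg h t .omega + cycDeg h t (.shift i) = cycDeg h t (.base i) + (1, 0) := by
        ext
        · simp [cycDeg]; ring
        · simp [cycDeg]
      rwa [e] at this
    | .shift i => by
      refine neg_mem ?_
      have := oddDer_mem (fun i => GCA.gen (cycDeg h t) (.base i))
        (fun i => gen_mem (deg := cycDeg h t) (.base i)) (-(2 * t - 1)) (odd_aux t)
        (fun i => GCA.gen (cycDeg h t) (.shift i))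
        (fun i => gen_mem (deg := cycDeg h t) (.shift i)) (h.diff_mem i)
      have e : h.deg i + (1, 0) + (-(2 * t - 1), 0) = cycDeg h t (.shift i) + (1, 0) := by
        simp only [cycDeg]; abel
      rwa [e] at this

/-- The generator `ω_{2t}` of the cyclification. -/
abbrev cycOmega : (h.cyc t).CE := (h.cyc t).gen CycGen.omega

/-- The generator `e^i` of the cyclification. -/
abbrev cycBase (i : h.Gen) : (h.cyc t).CE := (h.cyc t).gen (CycGen.base i)

/-- The generator `s_t e^i` of the cyclification. -/
abbrev cycShiftGen (i : h.Gen) : (h.cyc t).CE := (h.cyc t).gen (CycGen.shift i)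

variable {h t}

/-- `r : g → cyc_{2t-1}(h)` is the reduction `rdc_ω(f)` of `f : ĝ → h`, equivalently
`f = oxd_ω(r)`: it sends `ω_{2t} ↦ ω`, `e^i ↦ (f^* e^i)_bas` and `s_t e^i ↦ - p_*(f^* e^i)`. -/
def IsReduction {g : Presentation} {ω : g.CE} {hω : ω ∈ g.homog (2 * t, 0)}
    (f : Hom (g.ext t ω hω) h) (r : Hom g (h.cyc t)) : Prop :=
  r.pull (cycOmega h t) = ω ∧
  (∀ i, r.pull (cycBase h t i) = g.bas t ω hω (f.pull (h.gen i))) ∧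
  (∀ i, r.pull (cycShiftGen h t i) = - g.fib t ω hω (f.pull (h.gen i)))

end Cyc

end Presentation

open Presentation

/-! ## Classifying algebras -/

/-- The line Lie algebra `b^n ℝ`: one closed generator of bidegree `(n + 1, evn)`. -/
abbrev lineAlg (n : ℤ) : Presentation where
  Gen := Unit
  deg := fun _ => (n + 1, 0)
  diff := fun _ => 0
  diff_mem := fun _ => zero_mem _

/-- The generator `ω_{n+1}` of `CE(b^n ℝ)`. -/
abbrev lineGen (n : ℤ) : (lineAlg n).CE := (lineAlg n).gen ()

/-- Bidegrees of the generators of `twistAlg`. -/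
def twistDeg (n m : ℤ) : Option ℤ → BiDeg
  | none => (2 * n + 1, 0)
  | some k => (2 * n * k + m, 0)

/-- Differentials of the generators of `twistAlg`. -/
def twistDiff (n m : ℤ) : Option ℤ → GCA (twistDeg n m)
  | none => 0
  | some k => GCA.gen (twistDeg n m) none * GCA.gen (twistDeg n m) (some (k - 1))

theorem twistDiff_mem (n m : ℤ) : ∀ i, twistDiff n m i ∈
    GCA.homog (twistDeg n m) (twistDeg n m i + (1, 0)) := by
  rintro (_ | k)
  · rw [twistDiff]
    exact Submodule.zero_mem _
  · have h := mul_homog (gen_mem (deg := twistDeg n m) none)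
      (gen_mem (deg := twistDeg n m) (some (k - 1)))
    have e : twistDeg n m none + twistDeg n m (some (k - 1))
        = twistDeg n m (some k) + (1, 0) := by
      ext
      · simp [twistDeg]; ring
      · simp [twistDeg]
    rw [e] at h
    exact h

/-- The super-`L_∞` algebra `𝔩(Σ^m K^n U ⫽ B^{2n-1}U(1))` classifying `(2n+1)`-twisted cocycles
of degree `m` mod `2n`: generators `h_{2n+1}` and `f_{2nk+m}` (`k ∈ ℤ`), with `d h_{2n+1} = 0` and
`d f_{2n(k+1)+m} = h_{2n+1} f_{2nk+m}`. -/
abbrev twistAlg (n m : ℤ) : Presentation where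
  Gen := Option ℤ
  deg := twistDeg n m
  diff := twistDiff n m
  diff_mem := twistDiff_mem n m

/-- The generator `h_{2n+1}`. -/
abbrev twistH (n m : ℤ) : (twistAlg n m).CE := (twistAlg n m).gen none

/-- The generator `f_{2nk+m}`. -/
abbrev twistF (n m k : ℤ) : (twistAlg n m).CE := (twistAlg n m).gen (some k)

/-- The `H`-twisted cocycles of degree `m` mod `6` on `g`, for `H ∈ CE(g)` of bidegree
`(7, evn)`: homomorphisms from `g` to the classifying algebra with `h_7 ↦ H`. -/
def TwistedCocycle (g : Presentation) (H : g.CE) (m : ℤ) : Type :=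
  {F : Hom g (twistAlg 3 m) // F.pull (twistH 3 m) = H}

/-- The component `F_{6k+m}` of a twisted cocycle. -/
def TwistedCocycle.comp {g : Presentation} {H : g.CE} {m : ℤ} (F : TwistedCocycle g H m)
    (k : ℤ) : g.CE :=
  F.1.pull (twistF 3 m k)

/-! ## The isomorphisms of 3-cyclifications -/

/-- The automorphism of `b𝒯₂ = cyc₃(b^6 ℝ)`:
`ω₄ ↦ - s h₇`, `s h₇ ↦ - ω₄`, `h₇ ↦ h₇`. -/
def twistSwap : ((lineAlg 6).cyc 2).CE →ₐ[ℝ] ((lineAlg 6).cyc 2).CE :=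
  GCA.map
    (fun
      | .omega => - cycShiftGen (lineAlg 6) 2 ()
      | .base _ => cycBase (lineAlg 6) 2 ()
      | .shift _ => - cycOmega (lineAlg 6) 2)
    (fun
      | .omega => neg_mem (gen_mem (deg := cycDeg (lineAlg 6) 2) (.shift ()))
      | .base _ => gen_mem (deg := cycDeg (lineAlg 6) 2) (.base ())
      | .shift _ => neg_mem (gen_mem (deg := cycDeg (lineAlg 6) 2) .omega))

/-- The values on generators of `cocycleSwap`. -/
def cocycleSwapVal (m : ℤ) : CycGen (Option ℤ) → ((twistAlg 3 m).cyc 2).CE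
  | .omega => - cycShiftGen (twistAlg 3 m) 2 none
  | .base none => cycBase (twistAlg 3 m) 2 none
  | .base (some k) => cycShiftGen (twistAlg 3 m) 2 (some k)
  | .shift none => - cycOmega (twistAlg 3 m) 2
  | .shift (some k) => cycBase (twistAlg 3 m) 2 (some (k - 1))

theorem cocycleSwapVal_mem (m : ℤ) : ∀ i, cocycleSwapVal m i ∈
    ((twistAlg 3 m).cyc 2).homog (cycDeg (twistAlg 3 (m - 3)) 2 i)
  | .omega => neg_mem (gen_mem (deg := cycDeg (twistAlg 3 m) 2) (.shift none))
  | .base none => gen_mem (deg := cycDeg (twistAlg 3 m) 2) (.base none)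
  | .base (some k) => by
    have := gen_mem (deg := cycDeg (twistAlg 3 m) 2) (.shift (some k))
    have e : cycDeg (twistAlg 3 m) 2 (.shift (some k))
        = cycDeg (twistAlg 3 (m - 3)) 2 (.base (some k)) := by
      ext
      · simp [cycDeg, twistDeg]; ring
      · simp [cycDeg, twistDeg]
    rwa [e] at this
  | .shift none => neg_mem (gen_mem (deg := cycDeg (twistAlg 3 m) 2) .omega)
  | .shift (some k) => by
    have := gen_mem (deg := cycDeg (twistAlg 3 m) 2) (.base (some (k - 1)))
    have e : cycDeg (twistAlg 3 m) 2 (.base (some (k - 1)))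
        = cycDeg (twistAlg 3 (m - 3)) 2 (.shift (some k)) := by
      ext
      · simp [cycDeg, twistDeg]; ring
      · simp [cycDeg, twistDeg]
    rwa [e] at this

/-- The isomorphism of the 3-cyclifications of the classifying algebras in degrees `m` and `m - 3`,
as a map `CE(cyc₃ 𝔩(Σ^{m-3}…)) → CE(cyc₃ 𝔩(Σ^m…))`: it extends `twistSwap` by
`f_{6k-3+m} ↦ s f_{6k+m}` and `s f_{6k-3+m} ↦ f_{6(k-1)+m}`. -/
def cocycleSwap (m : ℤ) :
    ((twistAlg 3 (m - 3)).cyc 2).CE →ₐ[ℝ] ((twistAlg 3 m).cyc 2).CE :=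
  GCA.map (cocycleSwapVal m) (cocycleSwapVal_mem m)

/-- The twisting 7-cocycle `H'` on the extension of `g` by `ω'` arises from the twisting 7-cocycle
`H` on the extension of `g` by `ω` through reduction along `ω`, the automorphism of `b𝒯₂`, and
oxidation along `ω'`. -/
def TwistsTDual {g : Presentation} {ω ω' : g.CE} {hω : ω ∈ g.homog (2 * 2, 0)}
    {hω' : ω' ∈ g.homog (2 * 2, 0)} (H : Hom (g.ext 2 ω hω) (lineAlg 6))
    (H' : Hom (g.ext 2 ω' hω') (lineAlg 6)) : Prop :=
  ∃ r r' : Hom g ((lineAlg 6).cyc 2),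
    IsReduction H r ∧ r'.pull = r.pull.comp twistSwap ∧ IsReduction H' r'

/-- The twisted cocycle `F'` on the extension of `g` by `ω'` arises from the twisted cocycle
`F` on the extension of `g` by `ω` through reduction along `ω`, the isomorphism of cyclifications,
and oxidation along `ω'`. -/
def CocyclesTDual {g : Presentation} {ω ω' : g.CE} {hω : ω ∈ g.homog (2 * 2, 0)}
    {hω' : ω' ∈ g.homog (2 * 2, 0)} {H : (g.ext 2 ω hω).CE} {H' : (g.ext 2 ω' hω').CE} {m : ℤ}
    (F : TwistedCocycle (g.ext 2 ω hω) H m)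
    (F' : TwistedCocycle (g.ext 2 ω' hω') H' (m - 3)) : Prop :=
  ∃ (r : Hom g ((twistAlg 3 m).cyc 2)) (r' : Hom g ((twistAlg 3 (m - 3)).cyc 2)),
    IsReduction F.1 r ∧ r'.pull = r.pull.comp (cocycleSwap m) ∧ IsReduction F'.1 r'

/-! ## 11-dimensional super-Minkowski spacetime -/

/-- Index set of a basis of the real spinor representation `32 = (ℝ²)^{⊗5}`. -/
abbrev SpinorIdx : Type := Fin 2 × Fin 2 × Fin 2 × Fin 2 × Fin 2

/-- Real `2 × 2` matrices. -/
abbrev M₂ : Type := Matrix (Fin 2) (Fin 2) ℝ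

/-- The first Pauli matrix. -/
def sX : M₂ := !![0, 1; 1, 0]

/-- The third Pauli matrix. -/
def sZ : M₂ := !![1, 0; 0, -1]

/-- `i` times the second Pauli matrix. -/
def sE : M₂ := !![0, 1; -1, 0]

/-- The five-fold Kronecker product. -/
def kron5 (A B C D E : M₂) : Matrix SpinorIdx SpinorIdx ℝ := A ⊗ₖ (B ⊗ₖ (C ⊗ₖ (D ⊗ₖ E)))

/-- The Clifford generators `Γ_a`, `a = 0, …, 10`, of the Majorana representation `32`. -/
def Gam : Fin 11 → Matrix SpinorIdx SpinorIdx ℝ :=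
  ![kron5 1 1 1 1 sE,
    kron5 sE sE sE sE sX,
    kron5 1 sX sE sE sX,
    kron5 1 sZ sE sE sX,
    kron5 sX sE 1 sE sX,
    kron5 sZ sE 1 sE sX,
    kron5 sE 1 sX sE sX,
    kron5 sE 1 sZ sE sX,
    kron5 1 1 1 sX sX,
    kron5 1 1 1 sZ sX,
    kron5 1 1 1 1 sZ]

/-- The diagonal entries of the Minkowski metric `η = diag(-1, 1, …, 1)`. -/
def mink (a : Fin 11) : ℝ := if a = 0 then -1 else 1

/-- The spinor metric `η_{αβ}`, the matrix of the spinor pairing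
`(ψ̄ φ) = ψ^α η_{αβ} φ^β`. -/
def spinorMetric : Matrix SpinorIdx SpinorIdx ℝ := Gam 0

theorem kron5_mul (A B C D E A' B' C' D' E' : M₂) :
    kron5 A B C D E * kron5 A' B' C' D' E' =
      kron5 (A * A') (B * B') (C * C') (D * D') (E * E') := by
  simp only [kron5, ← Matrix.mul_kronecker_mul]

theorem kron5_neg (A B C D E : M₂) :
    kron5 (-A) B C D E = - kron5 A B C D E ∧ kron5 A (-B) C D E = - kron5 A B C D E ∧
    kron5 A B (-C) D E = - kron5 A B C D E ∧ kron5 A B C (-D) E = - kron5 A B C D E ∧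
    kron5 A B C D (-E) = - kron5 A B C D E := by
  refine ⟨?_, ?_, ?_, ?_, ?_⟩ <;> ext i j <;> simp [kron5]

theorem kron5_one : kron5 1 1 1 1 1 = 1 := by
  simp only [kron5, Matrix.one_kronecker_one]

theorem kron5_transpose (A B C D E : M₂) :
    (kron5 A B C D E).transpose
      = kron5 A.transpose B.transpose C.transpose D.transpose E.transpose := by
  ext i j; simp [kron5]

theorem pauli :
    sX * sX = 1 ∧ sZ * sZ = 1 ∧ sE * sE = -1 ∧ sX * sZ = -sE ∧ sZ * sX = sE ∧
    sX * sE = -sZ ∧ sE * sX = sZ ∧ sZ * sE = sX ∧ sE * sZ = -sX := by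
  refine ⟨?_, ?_, ?_, ?_, ?_, ?_, ?_, ?_, ?_⟩ <;> ext i j <;> fin_cases i <;> fin_cases j <;>
    simp [sX, sZ, sE]

theorem pauli_transpose :
    sX.transpose = sX ∧ sZ.transpose = sZ ∧ sE.transpose = -sE := by
  refine ⟨?_, ?_, ?_⟩ <;> ext i j <;> fin_cases i <;> fin_cases j <;> simp [sX, sZ, sE]

/-- The Clifford relation `Γ_a Γ_b + Γ_b Γ_a = 2 η_{ab}`. -/
theorem Gam_clifford (a b : Fin 11) :
    Gam a * Gam b + Gam b * Gam a = if a = b then (2 * mink a) • 1 else 0 := by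
  obtain ⟨h1, h2, h3, h4, h5, h6, h7, h8, h9⟩ := pauli
  fin_cases a <;> fin_cases b <;>
    simp [Gam, mink, kron5_mul, h1, h2, h3, h4, h5, h6, h7, h8, h9, kron5_neg, kron5_one] <;>
    module

/-- The volume element `Γ_0 Γ_1 ⋯ Γ_10` is the identity. -/
theorem Gam_volume : (List.ofFn Gam).prod = 1 := by
  obtain ⟨h1, h2, h3, h4, h5, h6, h7, h8, h9⟩ := pauli
  simp [Gam, kron5_mul, h3, h4, h6, kron5_neg, kron5_one]

/-- The spinor pairing is skew-symmetric. -/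
theorem spinorMetric_skew : spinorMetric.transpose = - spinorMetric := by
  simp [spinorMetric, Gam, kron5_transpose, pauli_transpose, kron5_neg]

/-- The spinor pairing is non-degenerate. -/
theorem spinorMetric_isUnit : IsUnit spinorMetric := by
  have h : spinorMetric * (- spinorMetric) = 1 := by
    obtain ⟨h1, h2, h3, h4, h5, h6, h7, h8, h9⟩ := pauli
    simp [spinorMetric, Gam, kron5_mul, kron5_neg, kron5_one, h3]
  exact IsUnit.of_mul_eq_one _ h

/-- The Clifford generators are skew self-adjoint for the spinor pairing. -/
theorem Gam_skewAdjoint (a : Fin 11) :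
    (Gam a).transpose * spinorMetric = - (spinorMetric * Gam a) := by
  obtain ⟨h1, h2, h3, h4, h5, h6, h7, h8, h9⟩ := pauli
  fin_cases a <;>
    simp [Gam, spinorMetric, kron5_transpose, pauli_transpose, kron5_mul, h3, h6, h7, h8, h9,
      kron5_neg, kron5_one]

/-- The skew-symmetrized products
`Γ_{a_1 ⋯ a_k} = (1/k!) ∑_σ sgn(σ) Γ_{a_σ(1)} ⋯ Γ_{a_σ(k)}`. -/
def GamSkew {k : ℕ} (a : Fin k → Fin 11) : Matrix SpinorIdx SpinorIdx ℝ :=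
  (k.factorial : ℝ)⁻¹ • ∑ σ : Equiv.Perm (Fin k),
    ((Equiv.Perm.sign σ : ℤ) : ℝ) • (List.ofFn fun i => Gam (a (σ i))).prod

/-- Generators of `CE(ℝ^{1,10|32})`: `ψ^α` and `e^a`. -/
inductive MinkGen : Type
  | psi : SpinorIdx → MinkGen
  | e : Fin 11 → MinkGen

/-- `deg ψ^α = (1, odd)` and `deg e^a = (1, evn)`. -/
def minkDeg : MinkGen → BiDeg
  | .psi _ => (1, 1)
  | .e _ => (1, 0)

/-- The generator `ψ^α`. -/
def psi (α : SpinorIdx) : GCA minkDeg := GCA.gen minkDeg (.psi α)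

/-- The generator `e^a`. -/
def vielb (a : Fin 11) : GCA minkDeg := GCA.gen minkDeg (.e a)

/-- The spinor bilinear `(ψ̄ M ψ) = ψ^α η_{αβ} M^β_γ ψ^γ`. -/
def bilin (M : Matrix SpinorIdx SpinorIdx ℝ) : GCA minkDeg :=
  ∑ α, ∑ γ, (spinorMetric * M) α γ • (psi α * psi γ)

theorem bilin_mem (M : Matrix SpinorIdx SpinorIdx ℝ) : bilin M ∈ GCA.homog minkDeg (2, 0) := by
  refine Submodule.sum_mem _ fun α _ => Submodule.sum_mem _ fun γ _ =>
    Submodule.smul_mem _ _ ?_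
  have h := mul_homog (gen_mem (deg := minkDeg) (.psi α)) (gen_mem (deg := minkDeg) (.psi γ))
  have e : minkDeg (.psi α) + minkDeg (.psi γ) = (2, 0) := by
    simp only [minkDeg]; decide
  rw [e] at h
  exact h

theorem vielb_mem (a : Fin 11) : vielb a ∈ GCA.homog minkDeg (1, 0) :=
  gen_mem (deg := minkDeg) (.e a)

/-- `d ψ^α = 0` and `d e^a = (ψ̄ Γ^a ψ)`, where `Γ^a = η^{ab} Γ_b`. -/
def minkDiff : MinkGen → GCA minkDeg
  | .psi _ => 0
  | .e a => bilin (mink a • Gam a)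

theorem minkDiff_mem : ∀ i, minkDiff i ∈ GCA.homog minkDeg (minkDeg i + (1, 0)) := by
  rintro (α | a)
  · rw [minkDiff]
    exact Submodule.zero_mem _
  · have e : minkDeg (.e a) + (1, 0) = (2, 0) := by simp only [minkDeg]; decide
    rw [minkDiff, e]
    exact bilin_mem _

/-- The 11-dimensional super-Minkowski algebra `ℝ^{1,10|32}`. -/
abbrev superMink : Presentation where
  Gen := MinkGen
  deg := minkDeg
  diff := minkDiff
  diff_mem := minkDiff_mem

/-- `G₄ = (1/2) (ψ̄ Γ_{a₁a₂} ψ) e^{a₁} e^{a₂}`. -/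
def G4 : superMink.CE :=
  (1 / 2 : ℝ) • ∑ a : Fin 2 → Fin 11,
    bilin (GamSkew a) * (List.ofFn fun i => vielb (a i)).prod

/-- `G₇ = (1/5!) (ψ̄ Γ_{a₁⋯a₅} ψ) e^{a₁} ⋯ e^{a₅}`. -/
def G7 : superMink.CE :=
  (1 / (Nat.factorial 5) : ℝ) • ∑ a : Fin 5 → Fin 11,
    bilin (GamSkew a) * (List.ofFn fun i => vielb (a i)).prod

theorem G4_mem : G4 ∈ superMink.homog (2 * 2, 0) := by
  refine Submodule.smul_mem _ _ (Submodule.sum_mem _ fun a _ => ?_)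
  have h := mul_homog (bilin_mem (GamSkew a))
    (mul_homog (vielb_mem (a 0)) (vielb_mem (a 1)))
  have e : ((2, 0) : BiDeg) + ((1, 0) + (1, 0)) = (2 * 2, 0) := by decide
  rw [e] at h
  simpa [List.ofFn_succ] using h

theorem neg_G4_mem : -G4 ∈ superMink.homog (2 * 2, 0) := neg_mem G4_mem

/-! ## The M2-brane extension and its reflected copy -/

/-- The extension `𝔪2𝔟𝔯𝔞𝔫𝔢` of `ℝ^{1,10|32}` by `G₄`: `d c₃ = G₄`. -/
abbrev m2brane : Presentation := superMink.ext 2 G4 G4_mem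

/-- The extension `𝔪2𝔟𝔯𝔞𝔫𝔢⁻` of `ℝ^{1,10|32}` by `-G₄`: `d c₃⁻ = -G₄`. -/
abbrev m2braneMinus : Presentation := superMink.ext 2 (-G4) neg_G4_mem

/-- The generator `c₃`. -/
abbrev c3 : m2brane.CE := superMink.extGen 2 G4 G4_mem

/-- The generator `c₃⁻`. -/
abbrev c3Minus : m2braneMinus.CE := superMink.extGen 2 (-G4) neg_G4_mem

/-- The inclusion `p^* : CE(ℝ^{1,10|32}) → CE(𝔪2𝔟𝔯𝔞𝔫𝔢)`. -/
abbrev pullP : superMink.CE →ₐ[ℝ] m2brane.CE := superMink.extIncl 2 G4 G4_mem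

/-- The inclusion `p_-^* : CE(ℝ^{1,10|32}) → CE(𝔪2𝔟𝔯𝔞𝔫𝔢⁻)`. -/
abbrev pullPMinus : superMink.CE →ₐ[ℝ] m2braneMinus.CE := superMink.extIncl 2 (-G4) neg_G4_mem

/-- The basic part of an element of `CE(𝔪2𝔟𝔯𝔞𝔫𝔢)`. -/
abbrev basP : m2brane.CE →ₐ[ℝ] superMink.CE := superMink.bas 2 G4 G4_mem

/-- The basic part of an element of `CE(𝔪2𝔟𝔯𝔞𝔫𝔢⁻)`. -/
abbrev basPMinus : m2braneMinus.CE →ₐ[ℝ] superMink.CE := superMink.bas 2 (-G4) neg_G4_mem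

/-- Fiber integration `p_*` on `CE(𝔪2𝔟𝔯𝔞𝔫𝔢)`. -/
abbrev fibP : m2brane.CE →ₗ[ℝ] superMink.CE := superMink.fib 2 G4 G4_mem

/-- Fiber integration `(p_-)_*` on `CE(𝔪2𝔟𝔯𝔞𝔫𝔢⁻)`. -/
abbrev fibPMinus : m2braneMinus.CE →ₗ[ℝ] superMink.CE := superMink.fib 2 (-G4) neg_G4_mem

/-- The Page charge `G̃₇ = 2 G₇ - c₃ G₄`. -/
def pageCharge : m2brane.CE := 2 * pullP G7 - c3 * pullP G4

/-- The reflected Page charge `G̃₇⁻ = 2 G₇ + c₃⁻ G₄`. -/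
def pageChargeMinus : m2braneMinus.CE := 2 * pullPMinus G7 + c3Minus * pullPMinus G4

end SuperLInfty

end

open SuperLInfty SuperLInfty.Presentation

open scoped Kronecker

noncomputable section

namespace SuperLInfty

open GCA

/-! ### Graded-commutative algebras: degrees, parity and signs -/

namespace GCA

variable {I J : Type} {deg : I → BiDeg} {deg' : J → BiDeg}

/-! Duality is a symmetry of equations on the base. Let `ω` and `ω'` be closed of degree 4 and `K`
of degree 7 with `d K = -ω ω'`. On the extension with `d b = ω`, an element is a pair `x + b y` of
basic elements, and `d (x + b y) = (d x + ω y) - b d y`. Hence `K + b ω'` is closed, and a family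
`F_k = x_k + b y_k` is a cocycle twisted by it exactly when `d x_k = K x_{k-1} - ω y_k` and `d y_k =
K y_{k-1} - ω' x_{k-1}`. Replacing `(x_k, y_k)` by `(-y_k, -x_{k-1})` gives the same system with `ω`
and `ω'` exchanged. This substitution is higher T-duality: on the base it is the exchange of
generators of the cyclifications. Doing it twice only shifts the index `k`, so it is invertible. The
hypotheses are collected in `IsDualityDatum`; the bijection is `dualEquiv`, and `cocyclesTDual`
identifies it with reduction, exchange and oxidation.

For the M2-brane `ω = G₄`, `ω' = -G₄` and `K = 2 G₇`, so what is needed is `d G₄ = 0` and `d G₇ =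
(1/2) G₄ G₄` (`d_G4`, `d_G7`). Since the `ψ^α` commute, these follow from polynomial identities in a
real spinor. The first, `(ψ̄ Γ^a ψ)(ψ̄ Γ_{ab} ψ) = 0` (`sum_spinorForm_Gam_mul`), comes from
splitting `32 = 16 ⊗ 2` and from the identity `∑ (x γ_i x)² = |x|⁴` for the nine symmetric gamma
matrices on `ℝ^16` (`sum_gam_sq`). The second (`sum_spinorForm_Gam_mul_five`) is the derivative of
the first in the direction `Γ_c Γ_d Γ_e ψ`.

As `ω' = -ω`, the reflection `b ↦ -b` turns the duality into a self-duality. It changes degrees by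
an odd number, so a component of the image that is a multiple of a component of `F` must vanish
(`eq_zero_of_mem_of_mem`). Non-triviality thus reduces to the existence of a nonzero twisted
cocycle, built from a non-closed element by `exists_comp_eq_d`. -/

theorem algHom_ext {B : Type} [Ring B] [Algebra ℝ B] {φ χ : GCA deg →ₐ[ℝ] B}
    (h : ∀ i, φ (gen deg i) = χ (gen deg i)) : φ = χ := by
  ext x
  induction x using GCA.induction with
  | algebraMap r => simp only [AlgHom.commutes]
  | gen i => exact h i
  | mul x y hx hy => simp only [map_mul, hx, hy]
  | add x y hx hy => simp only [map_add, hx, hy]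

theorem map_gen_eq_id : map (deg := deg) (gen deg) gen_mem = AlgHom.id ℝ (GCA deg) :=
  algHom_ext fun i => by simp

theorem algHom_invol (φ : GCA deg →ₐ[ℝ] GCA deg')
    (h : ∀ i, φ (gen deg i) ∈ homog deg' (deg i)) (x : GCA deg) :
    φ (invol deg x) = invol deg' (φ x) := by
  have : φ.comp (invol deg) = (invol deg').comp φ := algHom_ext fun i => by
    simp [invol_of_mem (h i)]
  exact DFunLike.congr_fun this x

/-- The algebra automorphism scaling elements of bidegree `(n, σ)` by `2 ^ n`. -/
def scale (deg : I → BiDeg) : GCA deg →ₐ[ℝ] GCA deg :=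
  map (fun i => (2 : ℝ) ^ (deg i).1 • gen deg i) fun i => Submodule.smul_mem _ _ (gen_mem i)

theorem scale_of_mem {a : BiDeg} {x : GCA deg} (hx : x ∈ homog deg a) :
    scale deg x = (2 : ℝ) ^ a.1 • x := by
  induction hx using Submodule.span_induction with
  | mem x hx =>
    obtain ⟨l, rfl, rfl⟩ := hx
    induction l with
    | nil => simp
    | cons i l ih =>
      have hi : scale deg (gen deg i) = (2 : ℝ) ^ (deg i).1 • gen deg i := map_gen _ _ i
      simp only [List.map_cons, List.prod_cons, List.sum_cons, map_mul, ih, hi, Prod.fst_add,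
        zpow_add₀ (two_ne_zero (α := ℝ)), smul_mul_assoc, mul_smul_comm, smul_smul]
      rw [mul_comm]
  | zero => simp
  | add y z _ _ h1 h2 => rw [map_add, h1, h2, smul_add]
  | smul r y _ h => rw [map_smul, h, smul_comm]

/-- Homogeneous subspaces in different degrees intersect trivially. -/
theorem eq_zero_of_mem_of_mem {a b : BiDeg} (hab : a.1 ≠ b.1) {x : GCA deg}
    (ha : x ∈ homog deg a) (hb : x ∈ homog deg b) : x = 0 := by
  -- The homogeneous subspaces are only spans in a quotient, with no basis at hand; the endomorphism
  -- `scale` separates them, as `x` would have the two different eigenvalues `2 ^ a.1` and `2 ^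
  -- b.1`.
  have h := (scale_of_mem ha).symm.trans (scale_of_mem hb)
  rw [← sub_eq_zero, ← sub_smul] at h
  refine (smul_eq_zero.mp h).resolve_left fun h0 => hab ?_
  exact zpow_right_injective₀ (a := (2 : ℝ)) (by norm_num) (by norm_num) (sub_eq_zero.mp h0)

theorem koszul_even_left (b : BiDeg) {k : ℤ} (hk : Even k) : koszul (k, 0) b = 1 := by
  simp [koszul, Int.negOnePow_even _ (hk.mul_right _)]

/-- Elements of bidegree `(even, evn)` are central. -/
theorem commute_of_mem_even {k : ℤ} (hk : Even k) {x : GCA deg} (hx : x ∈ homog deg (k, 0))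
    (y : GCA deg) : x * y = y * x := by
  induction y using GCA.induction with
  | algebraMap r => exact (Algebra.commutes r x).symm
  | gen i => rw [homog_comm hx (gen_mem i), koszul_even_left _ hk, one_smul]
  | mul y z hy hz => rw [← mul_assoc, hy, mul_assoc, hz, mul_assoc]
  | add y z hy hz => rw [mul_add, hy, hz, add_mul]

theorem parity_even {k : ℤ} (hk : Even k) (σ : ZMod 2) : parity (k, σ) = 1 := by
  simp [parity, Int.negOnePow_even _ hk]

theorem parity_odd {k : ℤ} (hk : Odd k) (σ : ZMod 2) : parity (k, σ) = -1 := by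
  simp [parity, Int.negOnePow_odd _ hk]

theorem invol_of_mem_even {k : ℤ} (hk : Even k) {σ : ZMod 2} {x : GCA deg}
    (hx : x ∈ homog deg (k, σ)) : invol deg x = x := by
  rw [invol_of_mem hx, parity_even hk, one_smul]

theorem invol_of_mem_odd {k : ℤ} (hk : Odd k) {σ : ZMod 2} {x : GCA deg}
    (hx : x ∈ homog deg (k, σ)) : invol deg x = -x := by
  rw [invol_of_mem hx, parity_odd hk, neg_one_smul]

/-- Elements of bidegree `(odd, evn)` square to zero. -/
theorem mul_self_of_mem_odd {k : ℤ} (hk : Odd k) {x : GCA deg} (hx : x ∈ homog deg (k, 0)) :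
    x * x = 0 := by
  have h := homog_comm hx hx
  rw [koszul_odd _ hk, parity_odd hk, neg_one_smul] at h
  have h2 : (2 : ℝ) • (x * x) = 0 := by
    rw [two_smul]; nth_rewrite 1 [h]; exact neg_add_cancel _
  exact (smul_eq_zero.mp h2).resolve_left two_ne_zero

end GCA

/-! ### The differential and homomorphisms, determined on generators -/

namespace Presentation

variable {g h : Presentation}

theorem d_gen (i : g.Gen) : g.d (g.gen i) = g.diff i := oddDer_gen _ _ _ _ _ _ i

theorem d_mul (x y : g.CE) : g.d (x * y) = g.d x * y + invol g.deg x * g.d y := by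
  have := oddDer_mul (GCA.gen g.deg) gen_mem 1 odd_one g.diff g.diff_mem x y
  rw [map_gen_eq_id] at this
  exact this

theorem d_one : g.d 1 = 0 := oddDer_one _ _ _ _ _ _

theorem d_algebraMap (r : ℝ) : g.d (algebraMap ℝ _ r) = 0 := by
  rw [Algebra.algebraMap_eq_smul_one, map_smul, d_one, smul_zero]

theorem d_mem {a : BiDeg} {x : g.CE} (hx : x ∈ g.homog a) : g.d x ∈ g.homog (a + (1, 0)) :=
  oddDer_mem _ _ _ _ _ _ hx

theorem d_mul_even {k : ℤ} (hk : Even k) {σ : ZMod 2} {x : g.CE} (hx : x ∈ g.homog (k, σ))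
    (y : g.CE) : g.d (x * y) = g.d x * y + x * g.d y := by
  rw [d_mul, invol_of_mem_even hk hx]

theorem d_mul_odd {k : ℤ} (hk : Odd k) {σ : ZMod 2} {x : g.CE} (hx : x ∈ g.homog (k, σ))
    (y : g.CE) : g.d (x * y) = g.d x * y - x * g.d y := by
  rw [d_mul, invol_of_mem_odd hk hx, neg_mul, sub_eq_add_neg]

theorem parity_add_one (a : BiDeg) : parity (a + (1, 0)) = -parity a := by
  simp [parity, Int.negOnePow_succ]

theorem d_invol (x : g.CE) : g.d (invol g.deg x) = -invol g.deg (g.d x) := by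
  induction x using GCA.induction with
  | algebraMap r => simp [d_algebraMap]
  | gen i =>
    rw [invol_gen, map_smul, d_gen, invol_of_mem (g.diff_mem i), parity_add_one, neg_smul, neg_neg]
  | mul x y hx hy =>
    simp only [map_mul, d_mul, map_add, hx, hy, neg_mul, mul_neg, neg_add]
  | add x y hx hy => simp only [map_add, hx, hy, neg_add]

/-- The differential is odd, so it anticommutes with the parity involution (`d_invol`). The cross
terms of `d (d (x y))` therefore cancel and `d ∘ d` is again determined by its values on generators.
-/
theorem isSuperLInfty_of_gen (hg : ∀ i, g.d (g.diff i) = 0) : g.IsSuperLInfty := by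
  intro x
  induction x using GCA.induction with
  | algebraMap r => simp [d_algebraMap]
  | gen i => rw [d_gen, hg]
  | mul x y hx hy =>
    simp [d_mul, map_add, d_invol, hx, hy]
  | add x y hx hy => simp only [map_add, hx, hy, add_zero]

/-- Both `φ ∘ d` and `d ∘ φ` are graded derivations along `φ`; agreement on generators suffices
because `φ` respects the parity signs. -/
theorem algHom_d (φ : h.CE →ₐ[ℝ] g.CE) (hφ : ∀ i, φ (h.gen i) ∈ g.homog (h.deg i))
    (hd : ∀ i, φ (h.diff i) = g.d (φ (h.gen i))) (x : h.CE) : φ (h.d x) = g.d (φ x) := by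
  induction x using GCA.induction with
  | algebraMap r => simp only [AlgHom.commutes, d_algebraMap, map_zero]
  | gen i => rw [d_gen]; exact hd i
  | mul x y hx hy =>
    simp only [d_mul, map_add, map_mul, hx, hy, algHom_invol φ hφ]
  | add x y hx hy => simp only [map_add, hx, hy]

/-- The homomorphism determined by the images of the generators. -/
def Hom.ofGen (f : h.Gen → g.CE) (hf : ∀ i, f i ∈ g.homog (h.deg i))
    (hd : ∀ i, GCA.map f hf (h.diff i) = g.d (f i)) : Hom g h where
  pull := GCA.map f hf
  pull_mem a x hx := GCA.map_mem f hf hx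
  pull_d := algHom_d _ (fun i => by rw [map_gen]; exact hf i) fun i => by rw [map_gen, hd]

theorem Hom.ext_gen {f f' : Hom g h} (H : ∀ i, f.pull (h.gen i) = f'.pull (h.gen i)) :
    f = f' := by
  have : f.pull = f'.pull := GCA.algHom_ext H
  cases f; cases f'; cases this; rfl

/-- Composition of homomorphisms. -/
def Hom.comp {k : Presentation} (f : Hom h k) (e : Hom g h) : Hom g k where
  pull := e.pull.comp f.pull
  pull_mem a x hx := e.pull_mem a _ (f.pull_mem a x hx)
  pull_d x := by simp [f.pull_d, e.pull_d]

/-! ### Extensions -/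

section Ext

variable (t : ℤ) (ω : g.CE) (hω : ω ∈ g.homog (2 * t, 0))

theorem basicPart_gen_some (i : g.Gen) :
    basicPart g t (GCA.gen (extDeg g t) (some i)) = g.gen i :=
  map_gen (basVal g) (basVal_mem g t) (some i)

theorem basicPart_gen_none : basicPart g t (GCA.gen (extDeg g t) none) = 0 :=
  map_gen (basVal g) (basVal_mem g t) none

theorem fiberInt_gen_some (i : g.Gen) : fiberInt g t (GCA.gen (extDeg g t) (some i)) = 0 :=
  oddDer_gen (basVal g) (basVal_mem g t) _ (odd_aux t) (fibVal g) (fibVal_mem g t) (some i)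

theorem fiberInt_gen_none : fiberInt g t (GCA.gen (extDeg g t) none) = 1 :=
  oddDer_gen (basVal g) (basVal_mem g t) _ (odd_aux t) (fibVal g) (fibVal_mem g t) none

theorem fiberInt_algebraMap (r : ℝ) : fiberInt g t (algebraMap ℝ _ r) = 0 := by
  rw [Algebra.algebraMap_eq_smul_one, map_smul, fiberInt, oddDer_one, smul_zero]

theorem basicPart_basicIncl (x : g.CE) : basicPart g t (basicIncl g t x) = x := by
  have : (basicPart g t).comp (basicIncl g t) = AlgHom.id ℝ _ :=
    GCA.algHom_ext fun i => by
      rw [AlgHom.comp_apply, basicIncl_gen, basicPart_gen_some, AlgHom.id_apply]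
  exact DFunLike.congr_fun this x

theorem fiberInt_basicIncl (x : g.CE) : fiberInt g t (basicIncl g t x) = 0 := by
  induction x using GCA.induction with
  | algebraMap r => rw [AlgHom.commutes, fiberInt_algebraMap]
  | gen i => rw [basicIncl_gen, fiberInt_gen_some]
  | mul x y hx hy => simp [fiberInt_mul, hx, hy]
  | add x y hx hy => simp only [map_add, hx, hy, add_zero]

theorem basicPart_gen_mul (x : GCA (extDeg g t)) :
    basicPart g t (GCA.gen (extDeg g t) none * x) = 0 := by
  rw [map_mul, basicPart_gen_none, zero_mul]

theorem fiberInt_gen_mul (x : g.CE) :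
    fiberInt g t (GCA.gen (extDeg g t) none * basicIncl g t x) = x := by
  rw [fiberInt_mul, fiberInt_basicIncl, basicPart_basicIncl]
  rw [fiberInt_gen_none, one_mul, mul_zero, add_zero]

theorem basicPart_incl_add (x y : g.CE) :
    basicPart g t (basicIncl g t x + GCA.gen (extDeg g t) none * basicIncl g t y) = x := by
  rw [map_add, basicPart_gen_mul, basicPart_basicIncl, add_zero]

theorem fiberInt_incl_add (x y : g.CE) :
    fiberInt g t (basicIncl g t x + GCA.gen (extDeg g t) none * basicIncl g t y) = y := by
  rw [map_add, fiberInt_gen_mul, fiberInt_basicIncl, zero_add]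

theorem eq_of_basicPart_of_fiberInt {x y : GCA (extDeg g t)}
    (h1 : basicPart g t x = basicPart g t y) (h2 : fiberInt g t x = fiberInt g t y) : x = y := by
  rw [basic_add_fiber g t x, basic_add_fiber g t y, h1, h2]

theorem basicPart_mem {a : BiDeg} {x : GCA (extDeg g t)} (hx : x ∈ GCA.homog (extDeg g t) a) :
    basicPart g t x ∈ g.homog a := GCA.map_mem _ _ hx

theorem fiberInt_mem {a : BiDeg} {x : GCA (extDeg g t)} (hx : x ∈ GCA.homog (extDeg g t) a) :
    fiberInt g t x ∈ g.homog (a + (-(2 * t - 1), 0)) := oddDer_mem _ _ _ _ _ _ hx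

theorem gen_none_mem : GCA.gen (extDeg g t) none ∈ GCA.homog (extDeg g t) (2 * t - 1, 0) :=
  gen_mem (deg := extDeg g t) none

theorem d_basicIncl (x : g.CE) : (g.ext t ω hω).d (basicIncl g t x) = basicIncl g t (g.d x) :=
  (algHom_d (g := g.ext t ω hω) (basicIncl g t)
    (fun i => basicIncl_mem g t (gen_mem i))
    (fun i => by rw [basicIncl_gen]; exact (d_gen (g := g.ext t ω hω) (some i)).symm) x).symm

theorem d_extGen : (g.ext t ω hω).d (GCA.gen (extDeg g t) none) = basicIncl g t ω :=
  d_gen (g := g.ext t ω hω) none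

/-- The term with `ω` comes from `d b = ω`, and the sign of the fibre component from moving `d` past
the odd generator `b`. All statements about differentials on an extension are read off from these
two components. -/
theorem d_incl_add (x y : g.CE) :
    (g.ext t ω hω).d (basicIncl g t x + GCA.gen (extDeg g t) none * basicIncl g t y) =
      basicIncl g t (g.d x + ω * y) + GCA.gen (extDeg g t) none * basicIncl g t (-g.d y) := by
  rw [map_add, d_basicIncl, d_mul_odd (g := g.ext t ω hω) ⟨t - 1, by ring⟩ (gen_none_mem t),
    d_basicIncl, d_extGen]
  simp only [map_add, map_mul, map_neg, mul_neg]
  abel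

theorem basicPart_d (x : GCA (extDeg g t)) :
    basicPart g t ((g.ext t ω hω).d x) = g.d (basicPart g t x) + ω * fiberInt g t x := by
  conv_lhs => rw [basic_add_fiber g t x, d_incl_add]
  exact basicPart_incl_add _ _ _

theorem fiberInt_d (x : GCA (extDeg g t)) :
    fiberInt g t ((g.ext t ω hω).d x) = -g.d (fiberInt g t x) := by
  conv_lhs => rw [basic_add_fiber g t x, d_incl_add]
  exact fiberInt_incl_add _ _ _

theorem isSuperLInfty_ext (hg : g.IsSuperLInfty) (hdω : g.d ω = 0) :
    (g.ext t ω hω).IsSuperLInfty := by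
  refine isSuperLInfty_of_gen ?_
  rintro (_ | i)
  · change (g.ext t ω hω).d (basicIncl g t ω) = 0
    rw [d_basicIncl, hdω, map_zero]
  · change (g.ext t ω hω).d (basicIncl g t (g.diff i)) = 0
    rw [d_basicIncl, ← d_gen, hg, map_zero]

end Ext

/-! ### Reduction -/

theorem cycIncl_gen (t : ℤ) (i : h.Gen) :
    cycIncl h t (h.gen i) = GCA.gen (cycDeg h t) (.base i) :=
  map_gen (deg := h.deg) _ _ i

theorem cycShift_gen (t : ℤ) (i : h.Gen) :
    cycShift h t (h.gen i) = GCA.gen (cycDeg h t) (.shift i) :=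
  oddDer_gen (deg := h.deg) (fun i => GCA.gen (cycDeg h t) (.base i))
    (fun i => gen_mem (deg := cycDeg h t) (.base i)) (-(2 * t - 1)) (odd_aux t)
    (fun i => GCA.gen (cycDeg h t) (.shift i))
    (fun i => gen_mem (deg := cycDeg h t) (.shift i)) i

theorem cycShift_algebraMap (t : ℤ) (r : ℝ) : cycShift h t (algebraMap ℝ _ r) = 0 := by
  rw [Algebra.algebraMap_eq_smul_one, map_smul]
  exact (congrArg (r • ·) (oddDer_one (deg := h.deg) _ _ _ _ _ _)).trans (smul_zero r)

/-- Every homomorphism out of an extension by a closed element has a reduction. -/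
theorem exists_isReduction {t : ℤ} {ω : g.CE} {hω : ω ∈ g.homog (2 * t, 0)} (hdω : g.d ω = 0)
    (f : Hom (g.ext t ω hω) h) : ∃ r : Hom g (h.cyc t), IsReduction f r := by
  -- The sign on the shifted generators is forced: `d e^i = d_h e^i + ω · s e^i` in the
  -- cyclification, whereas the basic part of `d α` is `d α_bas + ω · p_* α`.
  let v : CycGen h.Gen → g.CE
    | .omega => ω
    | .base i => basicPart g t (f.pull (h.gen i))
    | .shift i => -fiberInt g t (f.pull (h.gen i))
  have hf (i) : f.pull (h.gen i) ∈ GCA.homog (extDeg g t) (h.deg i) :=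
    f.pull_mem _ _ (gen_mem i)
  have hv : ∀ i, v i ∈ g.homog (cycDeg h t i)
    | .omega => hω
    | .base i => basicPart_mem t (hf i)
    | .shift i => neg_mem (fiberInt_mem t (hf i))
  have h1 (x : h.CE) : GCA.map (deg := cycDeg h t) v hv (cycIncl h t x)
      = basicPart g t (f.pull x) := by
    have : (GCA.map (deg := cycDeg h t) v hv).comp (cycIncl h t)
        = (basicPart g t).comp f.pull :=
      GCA.algHom_ext fun i => by
        rw [AlgHom.comp_apply, cycIncl_gen, map_gen, AlgHom.comp_apply]
    exact DFunLike.congr_fun this x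
  -- Shift and fibre integration have the same odd degree and obey the same Leibniz rule, so the
  -- generators decide.
  have h2 (x : h.CE) : GCA.map (deg := cycDeg h t) v hv (cycShift h t x)
      = -fiberInt g t (f.pull x) := by
    induction x using GCA.induction with
    | algebraMap r =>
      rw [AlgHom.commutes, cycShift_algebraMap, map_zero]
      exact (neg_eq_zero.mpr (fiberInt_algebraMap t r)).symm
    | gen i => rw [cycShift_gen, map_gen]
    | mul x y hx hy =>
      have e : cycShift h t (x * y) = cycShift h t x * cycIncl h t y
          + cycIncl h t (invol h.deg x) * cycShift h t y := oddDer_mul _ _ _ _ _ _ x y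
      rw [e, map_mul, fiberInt_mul, map_add, map_mul, map_mul, hx, hy, h1, h1,
        algHom_invol f.pull hf]
      noncomm_ring
    | add x y hx hy => simp only [map_add, hx, hy, neg_add]
  refine ⟨Hom.ofGen (h := h.cyc t) v hv ?_, ?_, ?_, ?_⟩
  -- The relations for `e^i` and `s e^i` are the basic and the fibre component of the equation
  -- saying that `f` is a chain map.
  · rintro (_ | i | i)
    · simp [cycDiff, v, hdω]
    · have := congrArg (basicPart g t) (f.pull_d (h.gen i))
      rw [basicPart_d, d_gen] at this
      simp [cycDiff, h1, v, this]
    · have := congrArg (fiberInt g t) (f.pull_d (h.gen i))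
      rw [fiberInt_d, d_gen] at this
      simp [cycDiff, h2, v, this]
  · exact map_gen v hv _
  · exact fun i => map_gen v hv _
  · exact fun i => map_gen v hv _

end Presentation

end SuperLInfty

namespace SuperLInfty

open GCA

/-! ### Twisted cocycles as families -/

namespace TwistedCocycle

variable {g : Presentation} {H : g.CE} {m : ℤ}

theorem comp_mem (F : TwistedCocycle g H m) (k : ℤ) : F.comp k ∈ g.homog (2 * 3 * k + m, 0) :=
  F.1.pull_mem _ _ (gen_mem (deg := twistDeg 3 m) (some k))

theorem d_comp (F : TwistedCocycle g H m) (k : ℤ) :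
    g.d (F.comp k) = H * F.comp (k - 1) := by
  have h := F.1.pull_d (twistF 3 m k)
  rw [d_gen (g := twistAlg 3 m)] at h
  refine h.symm.trans ?_
  change F.1.pull (twistH 3 m * twistF 3 m (k - 1)) = _
  rw [map_mul, F.2]
  rfl

theorem ext_comp {F F' : TwistedCocycle g H m} (h : ∀ k, F.comp k = F'.comp k) : F = F' := by
  refine Subtype.ext (Hom.ext_gen ?_)
  rintro (_ | k)
  · exact F.2.trans F'.2.symm
  · exact h k

theorem elim_mem (hH : H ∈ g.homog (2 * 3 + 1, 0)) {F : ℤ → g.CE}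
    (hF : ∀ k, F k ∈ g.homog (2 * 3 * k + m, 0)) :
    ∀ i : Option ℤ, i.elim H F ∈ g.homog (twistDeg 3 m i)
  | none => hH
  | some k => hF k

/-- The twisted cocycle with given components. -/
def ofFamily (hH : H ∈ g.homog (2 * 3 + 1, 0)) (hdH : g.d H = 0) (F : ℤ → g.CE)
    (hF : ∀ k, F k ∈ g.homog (2 * 3 * k + m, 0)) (hd : ∀ k, g.d (F k) = H * F (k - 1)) :
    TwistedCocycle g H m :=
  ⟨Hom.ofGen (h := twistAlg 3 m) (fun i => i.elim H F) (elim_mem hH hF)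
    (fun
      | none => by
        change GCA.map _ _ 0 = g.d H
        rw [map_zero, hdH]
      | some k => by
        change GCA.map _ _ (twistH 3 m * twistF 3 m (k - 1)) = g.d (F k)
        rw [map_mul, map_gen, map_gen, hd]
        rfl), map_gen _ (elim_mem hH hF) none⟩

@[simp] theorem ofFamily_comp (hH : H ∈ g.homog (2 * 3 + 1, 0)) (hdH : g.d H = 0) (F : ℤ → g.CE)
    (hF : ∀ k, F k ∈ g.homog (2 * 3 * k + m, 0)) (hd : ∀ k, g.d (F k) = H * F (k - 1)) (k : ℤ) :
    (ofFamily hH hdH F hF hd).comp k = F k :=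
  map_gen _ (elim_mem hH hF) (some k)

/-- The pullback of a twisted cocycle along a homomorphism. -/
def pullback {h : Presentation} {H' : h.CE} (f : Hom g h) (hf : f.pull H' = H)
    (F : TwistedCocycle h H' m) : TwistedCocycle g H m :=
  ⟨F.1.comp f, (congrArg f.pull F.2).trans hf⟩

/-- Pullback along an isomorphism. -/
def pullbackEquiv {h : Presentation} {H' : h.CE} (f : Hom g h) (f' : Hom h g)
    (hf : f.pull H' = H) (h1 : f.pull.comp f'.pull = AlgHom.id ℝ g.CE)
    (h2 : f'.pull.comp f.pull = AlgHom.id ℝ h.CE) (m : ℤ) :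
    TwistedCocycle h H' m ≃ TwistedCocycle g H m where
  toFun := pullback f hf
  invFun := pullback f' (by rw [← hf]; exact DFunLike.congr_fun h2 H')
  left_inv F := ext_comp fun k => DFunLike.congr_fun h2 (F.comp k)
  right_inv F := ext_comp fun k => DFunLike.congr_fun h1 (F.comp k)

/-- For `y` of degree `n`, the twisted cocycle with `F_{n+1} = d y` and `F_{n+7} = - H y`. -/
theorem exists_comp_eq_d (hg : g.IsSuperLInfty) (hH : H ∈ g.homog (2 * 3 + 1, 0))
    (hdH : g.d H = 0) {n : ℤ} {y : g.CE} (hy : y ∈ g.homog (n, 0)) (k : ℤ)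
    (hn : n + 1 = 2 * 3 * k + m) : ∃ F : TwistedCocycle g H m, F.comp k = g.d y := by
  have ho : Odd (2 * 3 + 1 : ℤ) := ⟨3, by norm_num⟩
  refine ⟨ofFamily hH hdH (fun j => if j = k then g.d y else if j = k + 1 then -(H * y) else 0)
    (fun j => ?_) (fun j => ?_), by simp⟩
  · split_ifs with h1 h2
    · have := d_mem hy
      rw [Prod.mk_add_mk, hn, add_zero] at this
      rwa [h1]
    · have := mul_homog hH hy
      rw [Prod.mk_add_mk, add_zero, show 2 * 3 + 1 + n = 2 * 3 * j + m by rw [h2]; linarith] at this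
      exact neg_mem this
    · exact zero_mem _
  -- The family has only two nonzero members: `d (-(H y)) = H d y` links them, since `H` is odd and
  -- closed, and `H H = 0` lets the family stop after the second.
  · have hHH : H * H = 0 := mul_self_of_mem_odd ho hH
    by_cases h1 : j = k
    · have e1 : k - 1 ≠ k + 1 := by omega
      simp [h1, hg y, e1]
    by_cases h2 : j = k + 1
    · simp [h2, d_mul_odd ho hH, hdH]
    by_cases h3 : j = k + 2
    · have e1 : k + 2 - 1 ≠ k := by omega
      have e2 : k + 2 - 1 = k + 1 := by ring
      simp only [h3, e2]
      simp [← mul_assoc, hHH]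
    · have e1 : j - 1 ≠ k := by omega
      have e2 : j - 1 ≠ k + 1 := by omega
      simp [h1, h2, e1, e2]

end TwistedCocycle

/-! ### Higher T-duality -/

/-- Closed elements `ω`, `ω'` of degree 4 and `K` of degree 7 with `d K = - ω ω'`: the data defining
a pair of T-dual extensions with twists `K + b ω'` and `K + b' ω`. -/
structure IsDualityDatum (g : Presentation) (ω ω' K : g.CE) : Prop where
  isSuperLInfty : g.IsSuperLInfty
  mem : ω ∈ g.homog (2 * 2, 0)
  mem' : ω' ∈ g.homog (2 * 2, 0)
  mem_K : K ∈ g.homog (2 * 3 + 1, 0)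
  d_K : g.d K = -(ω * ω')
  d_eq' : g.d ω' = 0
  d_eq : g.d ω = 0

/-- The twist `K + b ω'` on the extension by `ω`. -/
def extTwist (g : Presentation) (K ω' : g.CE) : GCA (extDeg g 2) :=
  basicIncl g 2 K + GCA.gen (extDeg g 2) none * basicIncl g 2 ω'

theorem basicPart_extTwist (g : Presentation) (K ω' : g.CE) :
    basicPart g 2 (extTwist g K ω') = K := basicPart_incl_add _ _ _

theorem fiberInt_extTwist (g : Presentation) (K ω' : g.CE) :
    fiberInt g 2 (extTwist g K ω') = ω' := fiberInt_incl_add _ _ _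

namespace IsDualityDatum

variable {g : Presentation} {ω ω' K : g.CE} (D : IsDualityDatum g ω ω' K)

/-- The condition on `d K` is symmetric because elements of degree 4 are central. -/
theorem symm (D : IsDualityDatum g ω ω' K) : IsDualityDatum g ω' ω K where
  isSuperLInfty := D.isSuperLInfty
  mem := D.mem'
  mem' := D.mem
  mem_K := D.mem_K
  d_eq := D.d_eq'
  d_eq' := D.d_eq
  d_K := by rw [D.d_K, commute_of_mem_even ⟨2, by norm_num⟩ D.mem]

theorem extTwist_mem : extTwist g K ω' ∈ (g.ext 2 ω D.mem).homog (2 * 3 + 1, 0) := by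
  refine add_mem (basicIncl_mem g 2 D.mem_K) ?_
  have := mul_homog (gen_none_mem (g := g) 2) (basicIncl_mem g 2 D.mem')
  rwa [Prod.mk_add_mk, add_zero, show (2 * 2 - 1 + 2 * 2 : ℤ) = 2 * 3 + 1 by norm_num] at this

/-- The basic component of the differential is `d K + ω ω'` and the fibre component is `-d ω'`; both
vanish by assumption. -/
theorem d_extTwist : (g.ext 2 ω D.mem).d (extTwist g K ω') = 0 := by
  refine (d_incl_add _ _ _ _ _).trans ?_
  rw [D.d_K, D.d_eq']
  simp

theorem ext_isSuperLInfty : (g.ext 2 ω D.mem).IsSuperLInfty :=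
  isSuperLInfty_ext 2 ω D.mem D.isSuperLInfty D.d_eq

theorem basicPart_extTwist_mul (x : GCA (extDeg g 2)) :
    basicPart g 2 (extTwist g K ω' * x) = K * basicPart g 2 x := by
  rw [map_mul, basicPart_extTwist]

/-- The minus sign arises because fibre integration has odd degree and moves past the odd element
`K`. -/
theorem fiberInt_extTwist_mul (D : IsDualityDatum g ω ω' K) (x : GCA (extDeg g 2)) :
    fiberInt g 2 (extTwist g K ω' * x) = ω' * basicPart g 2 x - K * fiberInt g 2 x := by
  rw [fiberInt_mul, fiberInt_extTwist, basicPart_invol, basicPart_extTwist,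
    invol_of_mem_odd ⟨3, by norm_num⟩ D.mem_K, neg_mul, sub_eq_add_neg]

/-- The twist as a homomorphism to the line algebra. -/
theorem exists_hom_extTwist : ∃ H : Hom (g.ext 2 ω D.mem) (lineAlg 6),
    H.pull (lineGen 6) = extTwist g K ω' :=
  ⟨Hom.ofGen (h := lineAlg 6) (fun _ => extTwist g K ω') (fun _ => D.extTwist_mem)
    (fun _ => by rw [D.d_extTwist]; exact map_zero _), map_gen _ (fun _ => D.extTwist_mem) ()⟩

/-- Reduction records the twists on the base as the images of `(ω₄, h₇, s h₇)`, namely `(ω, K, -ω')`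
and `(ω', K, -ω)`. The swap carries one triple to the other. -/
theorem twistsTDual {H : Hom (g.ext 2 ω D.mem) (lineAlg 6)}
    {H' : Hom (g.ext 2 ω' D.mem') (lineAlg 6)} (hH : H.pull (lineGen 6) = extTwist g K ω')
    (hH' : H'.pull (lineGen 6) = extTwist g K ω) : TwistsTDual H H' := by
  obtain ⟨r, hr⟩ := exists_isReduction D.d_eq H
  obtain ⟨r', hr'⟩ := exists_isReduction D.d_eq' H'
  refine ⟨r, r', hr, ?_, hr'⟩
  obtain ⟨h1, h2, h3⟩ := hr
  obtain ⟨h1', h2', h3'⟩ := hr'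
  have e1 := (h2 ()).trans (congrArg (basicPart g 2) hH)
  have e2 := (h3 ()).trans (congrArg (fun x => -fiberInt g 2 x) hH)
  have e1' := (h2' ()).trans (congrArg (basicPart g 2) hH')
  have e2' := (h3' ()).trans (congrArg (fun x => -fiberInt g 2 x) hH')
  rw [basicPart_extTwist] at e1 e1'
  simp only [fiberInt_extTwist] at e2 e2'
  refine GCA.algHom_ext ?_
  rintro (_ | ⟨⟩ | ⟨⟩)
  · rw [AlgHom.comp_apply, twistSwap, map_gen, map_neg]
    exact h1'.trans (by rw [e2, neg_neg])
  · rw [AlgHom.comp_apply, twistSwap, map_gen]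
    exact e1'.trans e1.symm
  · rw [AlgHom.comp_apply, twistSwap, map_gen, map_neg]
    exact e2'.trans (by rw [h1])

/-- Together with `d_fiberInt_comp` this is the twisted cocycle condition as a system on the base.
The system is invariant under exchanging `ω` with `ω'` and replacing the pair (basic part of `F_k`,
fibre part of `F_k`) by (minus fibre part of `F_k`, minus basic part of `F_{k-1}`). -/
theorem d_basicPart_comp {m : ℤ} (F : TwistedCocycle (g.ext 2 ω D.mem) (extTwist g K ω') m)
    (k : ℤ) : g.d (basicPart g 2 (F.comp k)) =
      K * basicPart g 2 (F.comp (k - 1)) - ω * fiberInt g 2 (F.comp k) := by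
  have h := congrArg (basicPart g 2) (F.d_comp k)
  rw [basicPart_d, basicPart_extTwist_mul] at h
  exact eq_sub_of_add_eq h

theorem d_fiberInt_comp {m : ℤ} (F : TwistedCocycle (g.ext 2 ω D.mem) (extTwist g K ω') m)
    (k : ℤ) : g.d (fiberInt g 2 (F.comp k)) =
      K * fiberInt g 2 (F.comp (k - 1)) - ω' * basicPart g 2 (F.comp (k - 1)) := by
  have h := congrArg (fiberInt g 2) (F.d_comp k)
  rw [fiberInt_d, D.fiberInt_extTwist_mul] at h
  rw [← neg_sub, ← h, neg_neg]

/-- The T-dual cocycle, with the components renumbered by `s`. -/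
def dual (s : ℤ) {m n : ℤ} (hn : n = m - 3 + 6 * s)
    (F : TwistedCocycle (g.ext 2 ω D.mem) (extTwist g K ω') m) :
    TwistedCocycle (g.ext 2 ω' D.mem') (extTwist g K ω) n :=
  TwistedCocycle.ofFamily D.symm.extTwist_mem D.symm.d_extTwist
    -- The parameter `s` lets one construction serve in both directions: `s = 0` lowers the degree
    -- from `m` to `m - 3`, and `s = 1` returns from `m - 3` to `m = (m - 3) - 3 + 6`.
    (fun k => basicIncl g 2 (-fiberInt g 2 (F.comp (k + s)))
      + GCA.gen (extDeg g 2) none * basicIncl g 2 (-basicPart g 2 (F.comp (k + s - 1))))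
    (fun k => by
      refine add_mem ?_ ?_
      · have := basicIncl_mem g 2 (neg_mem (fiberInt_mem 2 (F.comp_mem (k + s))))
        rwa [Prod.mk_add_mk, add_zero,
          show 2 * 3 * (k + s) + m + -(2 * 2 - 1) = 2 * 3 * k + n by rw [hn]; ring] at this
      · have := mul_homog (gen_none_mem (g := g) 2)
          (basicIncl_mem g 2 (neg_mem (basicPart_mem 2 (F.comp_mem (k + s - 1)))))
        rwa [Prod.mk_add_mk, add_zero,
          show 2 * 2 - 1 + (2 * 3 * (k + s - 1) + m) = 2 * 3 * k + n by rw [hn]; ring] at this)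
    (fun k => by
      refine eq_of_basicPart_of_fiberInt 2 ?_ ?_
      · rw [basicPart_d, basicPart_incl_add, fiberInt_incl_add, basicPart_extTwist_mul,
          basicPart_incl_add, map_neg, D.d_fiberInt_comp, sub_add_eq_add_sub k 1 s]
        noncomm_ring
      · rw [fiberInt_d, fiberInt_incl_add, D.symm.fiberInt_extTwist_mul, basicPart_incl_add,
          fiberInt_incl_add, map_neg, D.d_basicPart_comp, sub_add_eq_add_sub k 1 s]
        noncomm_ring)

theorem dual_comp (s : ℤ) {m n : ℤ} (hn : n = m - 3 + 6 * s)
    (F : TwistedCocycle (g.ext 2 ω D.mem) (extTwist g K ω') m) (k : ℤ) :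
    (D.dual s hn F).comp k = basicIncl g 2 (-fiberInt g 2 (F.comp (k + s)))
      + GCA.gen (extDeg g 2) none * basicIncl g 2 (-basicPart g 2 (F.comp (k + s - 1))) :=
  TwistedCocycle.ofFamily_comp _ _ _ _ _ k

theorem basicPart_dual_comp (s : ℤ) {m n : ℤ} (hn : n = m - 3 + 6 * s)
    (F : TwistedCocycle (g.ext 2 ω D.mem) (extTwist g K ω') m) (k : ℤ) :
    basicPart g 2 ((D.dual s hn F).comp k) = -fiberInt g 2 (F.comp (k + s)) := by
  rw [dual_comp]; exact basicPart_incl_add _ _ _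

theorem fiberInt_dual_comp (s : ℤ) {m n : ℤ} (hn : n = m - 3 + 6 * s)
    (F : TwistedCocycle (g.ext 2 ω D.mem) (extTwist g K ω') m) (k : ℤ) :
    fiberInt g 2 ((D.dual s hn F).comp k) = -basicPart g 2 (F.comp (k + s - 1)) := by
  rw [dual_comp]; exact fiberInt_incl_add _ _ _

/-- Two exchanges restore basic and fibre parts with sign `+` and move the index by `s + s' - 1`:
the `-1` is the delay `k - 1` that each passage from basic to fibre part introduces. -/
theorem dual_dual_comp {s s' : ℤ} (hs : s + s' = 1) {m n l : ℤ} (hn : n = m - 3 + 6 * s)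
    (hl : l = n - 3 + 6 * s') (F : TwistedCocycle (g.ext 2 ω D.mem) (extTwist g K ω') m) (k : ℤ) :
    (D.symm.dual s' hl (D.dual s hn F)).comp k = F.comp k := by
  refine eq_of_basicPart_of_fiberInt 2 ?_ ?_
  · rw [D.symm.basicPart_dual_comp, D.fiberInt_dual_comp, neg_neg,
      show k + s' + s - 1 = k by linarith]
  · rw [D.symm.fiberInt_dual_comp, D.basicPart_dual_comp, neg_neg,
      show k + s' - 1 + s = k by linarith]

/-- Higher T-duality as a bijection of twisted cocycles. -/
def dualEquiv (m : ℤ) : TwistedCocycle (g.ext 2 ω D.mem) (extTwist g K ω') m ≃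
    TwistedCocycle (g.ext 2 ω' D.mem') (extTwist g K ω) (m - 3) where
  toFun := D.dual 0 (by ring)
  invFun := D.symm.dual 1 (by ring)
  left_inv F := TwistedCocycle.ext_comp (D.dual_dual_comp (by norm_num) _ _ F)
  right_inv F := TwistedCocycle.ext_comp (D.symm.dual_dual_comp (by norm_num) _ _ F)

theorem dualEquiv_comp (m : ℤ) (F : TwistedCocycle (g.ext 2 ω D.mem) (extTwist g K ω') m)
    (k : ℤ) : (D.dualEquiv m F).comp k = -basicIncl g 2 (fiberInt g 2 (F.comp k))
      - GCA.gen (extDeg g 2) none * basicIncl g 2 (basicPart g 2 (F.comp (k - 1))) := by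
  refine (D.dual_comp 0 (by ring) F k).trans ?_
  simp only [add_zero, map_neg, mul_neg, sub_eq_add_neg]

theorem dualEquiv_symm_comp (m : ℤ)
    (F : TwistedCocycle (g.ext 2 ω' D.mem') (extTwist g K ω) (m - 3)) (k : ℤ) :
    ((D.dualEquiv m).symm F).comp k = -basicIncl g 2 (fiberInt g 2 (F.comp (k + 1)))
      - GCA.gen (extDeg g 2) none * basicIncl g 2 (basicPart g 2 (F.comp k)) := by
  refine (D.symm.dual_comp 1 (by ring) F k).trans ?_
  simp only [add_neg_cancel_right, map_neg, mul_neg, sub_eq_add_neg]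

theorem cocyclesTDual (m : ℤ) (F : TwistedCocycle (g.ext 2 ω D.mem) (extTwist g K ω') m) :
    CocyclesTDual F (D.dualEquiv m F) := by
  obtain ⟨r, hr⟩ := exists_isReduction D.d_eq F.1
  obtain ⟨r', hr'⟩ := exists_isReduction D.d_eq' (D.dualEquiv m F).1
  refine ⟨r, r', hr, ?_, hr'⟩
  obtain ⟨h1, h2, h3⟩ := hr
  obtain ⟨h1', h2', h3'⟩ := hr'
  have e1 := (h2 none).trans (congrArg (basicPart g 2) F.2)
  have e2 := (h3 none).trans (congrArg (fun x => -fiberInt g 2 x) F.2)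
  have e1' := (h2' none).trans (congrArg (basicPart g 2) (D.dualEquiv m F).2)
  have e2' := (h3' none).trans (congrArg (fun x => -fiberInt g 2 x) (D.dualEquiv m F).2)
  rw [basicPart_extTwist] at e1 e1'
  simp only [fiberInt_extTwist] at e2 e2'
  refine GCA.algHom_ext ?_
  -- The cases are `ω₄`, `h₇`, `f_k`, `s h₇`, `s f_k`. Those without `k` compare the twists as in
  -- `twistsTDual`; the other two are the definition of the dual components.
  rintro (_ | (_ | k) | (_ | k))
  · rw [AlgHom.comp_apply, cocycleSwap, map_gen, cocycleSwapVal, map_neg]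
    exact h1'.trans (by rw [e2, neg_neg])
  · rw [AlgHom.comp_apply, cocycleSwap, map_gen, cocycleSwapVal]
    exact e1'.trans e1.symm
  · rw [AlgHom.comp_apply, cocycleSwap, map_gen, cocycleSwapVal]
    refine (h2' (some k)).trans (Eq.trans ?_ (h3 (some k)).symm)
    refine (D.basicPart_dual_comp 0 (by ring) F k).trans ?_
    rw [add_zero]; rfl
  · rw [AlgHom.comp_apply, cocycleSwap, map_gen, cocycleSwapVal, map_neg]
    exact e2'.trans (by rw [h1])
  · rw [AlgHom.comp_apply, cocycleSwap, map_gen, cocycleSwapVal]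
    refine (h3' (some k)).trans (Eq.trans ?_ (h2 (some (k - 1))).symm)
    refine (congrArg Neg.neg (D.fiberInt_dual_comp 0 (by ring) F k)).trans ?_
    rw [neg_neg, add_zero]; rfl

end IsDualityDatum

/-! ### The reflection -/

section Reflection

variable {g : Presentation}

/-- The values on generators of the reflection `b ↦ -b`. -/
def reflVal (g : Presentation) : Option g.Gen → GCA (extDeg g 2)
  | none => -GCA.gen (extDeg g 2) none
  | some i => GCA.gen (extDeg g 2) (some i)

theorem reflVal_mem (g : Presentation) : ∀ i, reflVal g i ∈ GCA.homog (extDeg g 2) (extDeg g 2 i)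
  | none => neg_mem (gen_mem (deg := extDeg g 2) none)
  | some i => gen_mem (deg := extDeg g 2) (some i)

theorem map_reflVal_basicIncl (x : g.CE) :
    GCA.map (reflVal g) (reflVal_mem g) (basicIncl g 2 x) = basicIncl g 2 x := by
  have : (GCA.map (reflVal g) (reflVal_mem g)).comp (basicIncl g 2) = basicIncl g 2 :=
    GCA.algHom_ext fun i => by
      rw [AlgHom.comp_apply, basicIncl_gen, map_gen, reflVal]
  exact DFunLike.congr_fun this x

theorem map_reflVal_gen_none :
    GCA.map (reflVal g) (reflVal_mem g) (GCA.gen (extDeg g 2) none) =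
      -GCA.gen (extDeg g 2) none := map_gen _ _ none

theorem map_reflVal_comp_self :
    (GCA.map (reflVal g) (reflVal_mem g)).comp (GCA.map (reflVal g) (reflVal_mem g)) =
      AlgHom.id ℝ _ :=
  GCA.algHom_ext fun i => by
    rw [AlgHom.comp_apply, map_gen]
    cases i with
    | none => rw [reflVal, map_neg, map_reflVal_gen_none, neg_neg]; rfl
    | some i => rw [reflVal, map_gen]; rfl

/-- The reflection `b ↦ -b` between the extensions by `ω` and `-ω`. -/
def reflection {ω ω' : g.CE} (hω : ω ∈ g.homog (2 * 2, 0)) (hω' : ω' ∈ g.homog (2 * 2, 0))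
    (h : ω' = -ω) : Hom (g.ext 2 ω hω) (g.ext 2 ω' hω') :=
  Hom.ofGen (h := g.ext 2 ω' hω') (reflVal g) (reflVal_mem g) fun
    | none => by
      change GCA.map (reflVal g) (reflVal_mem g) (basicIncl g 2 ω') =
        (g.ext 2 ω hω).d (-GCA.gen (extDeg g 2) none)
      rw [map_reflVal_basicIncl, map_neg, d_extGen, h, map_neg]
    | some i => by
      change GCA.map (reflVal g) (reflVal_mem g) (basicIncl g 2 (g.diff i)) =
        (g.ext 2 ω hω).d (GCA.gen (extDeg g 2) (some i))
      rw [map_reflVal_basicIncl]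
      exact (d_gen (g := g.ext 2 ω hω) (some i)).symm

theorem map_reflVal_extTwist (K ω' : g.CE) :
    GCA.map (reflVal g) (reflVal_mem g) (extTwist g K ω') = extTwist g K (-ω') := by
  rw [extTwist, map_add, map_mul, map_reflVal_basicIncl, map_reflVal_basicIncl,
    map_reflVal_gen_none, extTwist, map_neg, mul_neg, neg_mul]

end Reflection

/-! ### The self-duality and its non-triviality -/

namespace IsDualityDatum

variable {g : Presentation} {ω ω' K : g.CE} (D : IsDualityDatum g ω ω' K) (h : ω' = -ω)

theorem reflection_extTwist : (reflection D.mem D.mem' h).pull (extTwist g K ω) = extTwist g K ω' :=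
  (map_reflVal_extTwist K ω).trans (by rw [h])

/-- The self-duality obtained from higher T-duality by pullback along the reflection. -/
def selfDualEquiv (m : ℤ) : TwistedCocycle (g.ext 2 ω D.mem) (extTwist g K ω') m ≃
    TwistedCocycle (g.ext 2 ω D.mem) (extTwist g K ω') (m - 3) :=
  (D.dualEquiv m).trans (TwistedCocycle.pullbackEquiv (reflection D.mem D.mem' h)
    (reflection D.mem' D.mem (by rw [h, neg_neg])) (D.reflection_extTwist h)
    map_reflVal_comp_self map_reflVal_comp_self (m - 3))

theorem selfDualEquiv_comp (m : ℤ) (F : TwistedCocycle (g.ext 2 ω D.mem) (extTwist g K ω') m)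
    (k : ℤ) : (D.selfDualEquiv h m F).comp k = -basicIncl g 2 (fiberInt g 2 (F.comp k))
      + GCA.gen (extDeg g 2) none * basicIncl g 2 (basicPart g 2 (F.comp (k - 1))) := by
  refine (congrArg (GCA.map (reflVal g) (reflVal_mem g)) (D.dualEquiv_comp m F k)).trans ?_
  rw [map_sub, map_neg, map_mul, map_reflVal_basicIncl, map_reflVal_basicIncl,
    map_reflVal_gen_none, neg_mul, sub_neg_eq_add]

/-- If there are non-closed elements in all odd positive degrees, then the extension has non-closed
elements in suitable degrees of any given residue. -/
theorem exists_d_ne_zero (hz : ∀ n : ℕ, ∃ z ∈ g.homog (2 * n + 1, 0), g.d z ≠ 0) (m : ℤ) :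
    ∃ (n k : ℤ) (y : (g.ext 2 ω D.mem).CE), n + 1 = 2 * 3 * k + m ∧
      y ∈ (g.ext 2 ω D.mem).homog (n, 0) ∧ (g.ext 2 ω D.mem).d y ≠ 0 := by
  -- For even `m` the degree `n` is odd and a basic element `z` serves; for odd `m` it is even and
  -- the odd generator of degree 3 is put in front of `z`. The choice `k = |l| + 1` keeps the
  -- argument of `toNat` nonnegative, so that no truncation occurs.
  rcases Int.even_or_odd' m with ⟨l, hl | hl⟩
  · obtain ⟨z, hz, hdz⟩ := hz (3 * (l.natAbs + 1) + l - 1).toNat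
    refine ⟨_, l.natAbs + 1, basicIncl g 2 z, ?_, basicIncl_mem g 2 hz, fun h0 => hdz ?_⟩
    · omega
    · rw [d_basicIncl] at h0
      rw [← basicPart_basicIncl 2 (g.d z)]
      exact (congrArg _ h0).trans (map_zero _)
  · obtain ⟨z, hz, hdz⟩ := hz (3 * (l.natAbs + 1) + l - 2).toNat
    have hy := mul_homog (gen_none_mem (g := g) 2) (basicIncl_mem g 2 hz)
    rw [Prod.mk_add_mk, add_zero] at hy
    refine ⟨_, l.natAbs + 1, GCA.gen (extDeg g 2) none * basicIncl g 2 z, ?_, hy, fun h0 => hdz ?_⟩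
    · omega
    · have := congrArg (fiberInt g 2) h0
      rw [fiberInt_d, fiberInt_gen_mul] at this
      exact neg_eq_zero.mp (this.trans (map_zero _))

/-- Components of the image have degree `m - 3` modulo 6 and components of `F` degree `m`, so a
component of the image that is a multiple of one of `F` is zero. It remains to find a cocycle whose
image has a nonzero component. -/
theorem selfDualEquiv_nontrivial (hz : ∀ n : ℕ, ∃ z ∈ g.homog (2 * n + 1, 0), g.d z ≠ 0)
    (m : ℤ) : ∃ F k, ∀ (j : ℤ) (c : ℝ), (D.selfDualEquiv h m F).comp k ≠ c • F.comp j := by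
  obtain ⟨n, k, y, hn, hy, hdy⟩ := D.exists_d_ne_zero hz m
  obtain ⟨F, hF⟩ := TwistedCocycle.exists_comp_eq_d D.ext_isSuperLInfty D.extTwist_mem D.d_extTwist
    hy k hn
  have key : ∃ k, (D.selfDualEquiv h m F).comp k ≠ 0 := by
    -- If the whole image vanished, its component at `k + 1` would kill the basic part of `F_k` and
    -- its component at `k` the fibre part, contradicting `F_k = d y ≠ 0`.
    by_contra! h0
    refine hdy (hF.symm.trans (eq_of_basicPart_of_fiberInt 2 ?_ ?_))
    · have := congrArg (fiberInt g 2) (h0 (k + 1))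
      rw [selfDualEquiv_comp, ← map_neg, fiberInt_incl_add, add_sub_cancel_right] at this
      exact this.trans ((map_zero _).trans (map_zero _).symm)
    · have := congrArg (basicPart g 2) (h0 k)
      rw [selfDualEquiv_comp, ← map_neg, basicPart_incl_add, map_zero] at this
      exact (neg_eq_zero.mp this).trans (map_zero _).symm
  obtain ⟨k, hk⟩ := key
  refine ⟨F, k, fun j c hc => hk ?_⟩
  refine eq_zero_of_mem_of_mem (a := (2 * 3 * k + (m - 3), 0)) (b := (2 * 3 * j + m, 0)) ?_
    (TwistedCocycle.comp_mem _ k) ?_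
  · simp only; omega
  · rw [hc]; exact Submodule.smul_mem _ c (F.comp_mem j)

end IsDualityDatum

end SuperLInfty

namespace SuperLInfty

open Matrix

/-! ### Symmetric gamma matrices in nine dimensions -/

/-- Index set of a basis of `16 = (ℝ²)^{⊗4}`. -/
abbrev HalfIdx : Type := Fin 2 × Fin 2 × Fin 2 × Fin 2

/-- The four-fold Kronecker product. -/
def kron4 (A B C D : M₂) : Matrix HalfIdx HalfIdx ℝ := A ⊗ₖ (B ⊗ₖ (C ⊗ₖ D))

/-- The symmetric Clifford generators of `Spin(9)` on `ℝ^16`. -/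
def gam : Fin 9 → Matrix HalfIdx HalfIdx ℝ :=
  ![kron4 sE sE sE sE,
    kron4 1 sX sE sE,
    kron4 1 sZ sE sE,
    kron4 sX sE 1 sE,
    kron4 sZ sE 1 sE,
    kron4 sE 1 sX sE,
    kron4 sE 1 sZ sE,
    kron4 1 1 1 sX,
    kron4 1 1 1 sZ]

/-- The quadratic identity behind the octonionic Hopf fibration `S^15 → S^8`. -/
theorem sum_gam_sq (x : HalfIdx → ℝ) :
    ∑ i, (x ⬝ᵥ gam i *ᵥ x) ^ 2 = (x ⬝ᵥ x) ^ 2 := by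
  -- Written out in the sixteen coordinates of `x`, this is an identity between quartic polynomials.
  simp only [Fin.sum_univ_succ, Fin.sum_univ_zero, gam, kron4, dotProduct, mulVec,
    Fintype.sum_prod_type, sX, sZ, sE]
  simp
  ring

end SuperLInfty

namespace SuperLInfty

open Matrix

theorem gam_transpose (i : Fin 9) : (gam i)ᵀ = gam i := by
  have h (A B C D : M₂) : (kron4 A B C D)ᵀ = kron4 Aᵀ Bᵀ Cᵀ Dᵀ := by ext i j; simp [kron4]
  have hn (A B C D : M₂) : kron4 (-A) B C D = -kron4 A B C D ∧ kron4 A (-B) C D = -kron4 A B C D ∧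
      kron4 A B (-C) D = -kron4 A B C D ∧ kron4 A B C (-D) = -kron4 A B C D := by
    refine ⟨?_, ?_, ?_, ?_⟩ <;> ext i j <;> simp [kron4]
  fin_cases i <;> simp [gam, h, pauli_transpose, hn]

theorem gam_clifford (i j : Fin 9) :
    gam i * gam j + gam j * gam i = if i = j then (2 : ℝ) • 1 else 0 := by
  have hm (A B C D A' B' C' D' : M₂) :
      kron4 A B C D * kron4 A' B' C' D' = kron4 (A * A') (B * B') (C * C') (D * D') := by
    simp only [kron4, ← Matrix.mul_kronecker_mul]
  have hn (A B C D : M₂) : kron4 (-A) B C D = -kron4 A B C D ∧ kron4 A (-B) C D = -kron4 A B C D ∧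
      kron4 A B (-C) D = -kron4 A B C D ∧ kron4 A B C (-D) = -kron4 A B C D := by
    refine ⟨?_, ?_, ?_, ?_⟩ <;> ext i j <;> simp [kron4]
  have h1 : kron4 1 1 1 1 = 1 := by simp only [kron4, Matrix.one_kronecker_one]
  obtain ⟨p1, p2, p3, p4, p5, p6, p7, p8, p9⟩ := pauli
  fin_cases i <;> fin_cases j <;>
    simp [gam, hm, p1, p2, p3, p4, p5, p6, p7, p8, p9, hn, h1] <;> module

theorem dotProduct_gam_comm (i : Fin 9) (x y : HalfIdx → ℝ) :
    x ⬝ᵥ gam i *ᵥ y = y ⬝ᵥ gam i *ᵥ x := by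
  rw [dotProduct_mulVec, ← mulVec_transpose, gam_transpose, dotProduct_comm]

/-- The linear coefficient of a sum of products of quadratic polynomials vanishing identically. -/
theorem sum_linear_coeff_eq_zero {ι : Type*} [Fintype ι] (a₀ a₁ a₂ b₀ b₁ b₂ : ι → ℝ)
    (h : ∀ t : ℝ, ∑ i, (a₀ i + t * a₁ i + t ^ 2 * a₂ i) * (b₀ i + t * b₁ i + t ^ 2 * b₂ i) = 0) :
    ∑ i, (a₁ i * b₀ i + a₀ i * b₁ i) = 0 := by
  -- The five-point central difference `(8 (p(1) - p(-1)) - (p(2) - p(-2))) / 12` equals `p'(0)`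
  -- exactly for polynomials `p` of degree at most 4.
  have e : ∑ i, (a₁ i * b₀ i + a₀ i * b₁ i) = 12⁻¹ *
      (8 * (∑ i, (a₀ i + 1 * a₁ i + 1 ^ 2 * a₂ i) * (b₀ i + 1 * b₁ i + 1 ^ 2 * b₂ i)
        - ∑ i, (a₀ i + (-1) * a₁ i + (-1) ^ 2 * a₂ i) * (b₀ i + (-1) * b₁ i + (-1) ^ 2 * b₂ i))
      - (∑ i, (a₀ i + 2 * a₁ i + 2 ^ 2 * a₂ i) * (b₀ i + 2 * b₁ i + 2 ^ 2 * b₂ i)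
        - ∑ i, (a₀ i + (-2) * a₁ i + (-2) ^ 2 * a₂ i)
          * (b₀ i + (-2) * b₁ i + (-2) ^ 2 * b₂ i))) := by
    rw [← Finset.sum_sub_distrib, ← Finset.sum_sub_distrib, Finset.mul_sum,
      ← Finset.sum_sub_distrib, Finset.mul_sum]
    exact Finset.sum_congr rfl fun i _ => by ring
  rw [e, h, h, h, h]
  ring

theorem dotProduct_mulVec_add_smul {n : Type*} [Fintype n] (M : Matrix n n ℝ) (x y : n → ℝ)
    (t : ℝ) : (x + t • y) ⬝ᵥ M *ᵥ (x + t • y) =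
      x ⬝ᵥ M *ᵥ x + t * (x ⬝ᵥ M *ᵥ y + y ⬝ᵥ M *ᵥ x) + t ^ 2 * (y ⬝ᵥ M *ᵥ y) := by
  simp only [mulVec_add, mulVec_smul, add_dotProduct, dotProduct_add, smul_dotProduct,
    dotProduct_smul, smul_eq_mul]
  ring

/-- This is the coefficient of `t` in `sum_gam_sq` at `x + t y`. The right-hand side of that
identity is carried along as one more summand, indexed by `none`, so that the sum vanishes
identically. -/
theorem sum_gam_polarized (x y : HalfIdx → ℝ) :
    ∑ i, (x ⬝ᵥ gam i *ᵥ x) * (x ⬝ᵥ gam i *ᵥ y) = (x ⬝ᵥ x) * (x ⬝ᵥ y) := by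
  have h := sum_linear_coeff_eq_zero (ι := Option (Fin 9))
    (fun i => i.elim (x ⬝ᵥ x) fun i => x ⬝ᵥ gam i *ᵥ x)
    (fun i => i.elim (x ⬝ᵥ y + y ⬝ᵥ x) fun i => x ⬝ᵥ gam i *ᵥ y + y ⬝ᵥ gam i *ᵥ x)
    (fun i => i.elim (y ⬝ᵥ y) fun i => y ⬝ᵥ gam i *ᵥ y)
    (fun i => i.elim (-(x ⬝ᵥ x)) fun i => x ⬝ᵥ gam i *ᵥ x)
    (fun i => i.elim (-(x ⬝ᵥ y + y ⬝ᵥ x)) fun i => x ⬝ᵥ gam i *ᵥ y + y ⬝ᵥ gam i *ᵥ x)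
    (fun i => i.elim (-(y ⬝ᵥ y)) fun i => y ⬝ᵥ gam i *ᵥ y) (fun t => by
      have e := sum_gam_sq (x + t • y)
      have e1 := dotProduct_mulVec_add_smul 1 x y t
      simp only [one_mulVec] at e1
      simp only [dotProduct_mulVec_add_smul, e1] at e
      rw [Fintype.sum_option]
      simp only [Option.elim, ← pow_two, e]
      ring)
  rw [Fintype.sum_option] at h
  simp only [Option.elim, dotProduct_gam_comm _ y x, dotProduct_comm y x] at h
  have e : ∑ i, ((x ⬝ᵥ gam i *ᵥ y + x ⬝ᵥ gam i *ᵥ y) * (x ⬝ᵥ gam i *ᵥ x)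
      + (x ⬝ᵥ gam i *ᵥ x) * (x ⬝ᵥ gam i *ᵥ y + x ⬝ᵥ gam i *ᵥ y))
      = 4 * ∑ i, (x ⬝ᵥ gam i *ᵥ x) * (x ⬝ᵥ gam i *ᵥ y) := by
    rw [Finset.mul_sum]
    exact Finset.sum_congr rfl fun i _ => by ring
  rw [e] at h
  linarith

/-! ### Splitting of spinors -/

/-- The decomposition `32 = 16 ⊗ 2` of the index set. -/
def spinorSplit : SpinorIdx ≃ HalfIdx × Fin 2 where
  toFun a := ((a.1, a.2.1, a.2.2.1, a.2.2.2.1), a.2.2.2.2)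
  invFun a := (a.1.1, a.1.2.1, a.1.2.2.1, a.1.2.2.2, a.2)
  left_inv _ := rfl
  right_inv _ := rfl

/-- The Kronecker product of a `16 × 16` and a `2 × 2` matrix. -/
def kronHalf (M : Matrix HalfIdx HalfIdx ℝ) (E : M₂) : Matrix SpinorIdx SpinorIdx ℝ :=
  (M ⊗ₖ E).submatrix spinorSplit spinorSplit

theorem kron5_eq_kronHalf (A B C D E : M₂) : kron5 A B C D E = kronHalf (kron4 A B C D) E := by
  ext i j
  simp [kron5, kronHalf, kron4, spinorSplit, mul_assoc]

theorem kronHalf_mul (M N : Matrix HalfIdx HalfIdx ℝ) (E F : M₂) :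
    kronHalf M E * kronHalf N F = kronHalf (M * N) (E * F) := by
  rw [kronHalf, kronHalf, submatrix_mul_equiv, ← mul_kronecker_mul, kronHalf]

theorem dotProduct_kronecker {l n : Type*} [Fintype l] [Fintype n] (M : Matrix l l ℝ)
    (E : Matrix n n ℝ) (φ : l × n → ℝ) :
    φ ⬝ᵥ (M ⊗ₖ E) *ᵥ φ =
      ∑ m, ∑ m', E m m' * ((fun i => φ (i, m)) ⬝ᵥ M *ᵥ fun i => φ (i, m')) := by
  simp only [dotProduct, mulVec, Fintype.sum_prod_type_right, Finset.mul_sum, kroneckerMap_apply]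
  refine Finset.sum_congr rfl fun m _ => ?_
  rw [Finset.sum_comm]
  refine Finset.sum_congr rfl fun n _ => Finset.sum_congr rfl fun i _ =>
    Finset.sum_congr rfl fun j _ => ?_
  ring

theorem dotProduct_kronHalf (M : Matrix HalfIdx HalfIdx ℝ) (E : M₂) (ψ : SpinorIdx → ℝ) :
    ψ ⬝ᵥ kronHalf M E *ᵥ ψ = ∑ m, ∑ n, E m n *
      ((fun i => ψ (spinorSplit.symm (i, m))) ⬝ᵥ M *ᵥ fun i => ψ (spinorSplit.symm (i, n))) := by
  rw [kronHalf, submatrix_mulVec_equiv, ← comp_equiv_symm_dotProduct, dotProduct_kronecker]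
  rfl

theorem Gam_zero : Gam 0 = kronHalf 1 sE := by
  have h1 : kron4 1 1 1 1 = 1 := by simp only [kron4, Matrix.one_kronecker_one]
  rw [← h1, ← kron5_eq_kronHalf]; rfl

theorem Gam_castSucc_succ (i : Fin 9) : Gam i.castSucc.succ = kronHalf (gam i) sX := by
  fin_cases i <;> exact kron5_eq_kronHalf _ _ _ _ _

theorem Gam_last : Gam (Fin.last 9).succ = kronHalf 1 sZ := by
  have h1 : kron4 1 1 1 1 = 1 := by simp only [kron4, Matrix.one_kronecker_one]
  rw [← h1, ← kron5_eq_kronHalf]; rfl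

/-- The quadratic form `(ψ̄ M ψ)` of a real spinor `ψ`. -/
def spinorForm (ψ : SpinorIdx → ℝ) (M : Matrix SpinorIdx SpinorIdx ℝ) : ℝ :=
  ψ ⬝ᵥ (spinorMetric * M) *ᵥ ψ

theorem spinorForm_kronHalf (ψ : SpinorIdx → ℝ) (M : Matrix HalfIdx HalfIdx ℝ) (E : M₂) :
    spinorForm ψ (kronHalf M E) = ∑ m, ∑ n, (sE * E) m n *
      ((fun i => ψ (spinorSplit.symm (i, m))) ⬝ᵥ M *ᵥ fun i => ψ (spinorSplit.symm (i, n))) := by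
  rw [spinorForm, spinorMetric, Gam_zero, kronHalf_mul, one_mul, dotProduct_kronHalf]

/-- Transposition reverses the product of the two symmetric matrices, and the Clifford relation
restores the order. -/
theorem gam_mul_swap (i j : Fin 9) (x y : HalfIdx → ℝ) :
    x ⬝ᵥ (gam i * gam j) *ᵥ y =
      (if i = j then 2 * (x ⬝ᵥ y) else 0) - y ⬝ᵥ (gam i * gam j) *ᵥ x := by
  have h1 : y ⬝ᵥ (gam i * gam j) *ᵥ x = x ⬝ᵥ (gam j * gam i) *ᵥ y := by
    rw [dotProduct_mulVec, ← mulVec_transpose, transpose_mul, gam_transpose, gam_transpose,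
      dotProduct_comm]
  rw [h1, eq_sub_iff_add_eq, ← dotProduct_add, ← add_mulVec, gam_clifford]
  split_ifs
  · rw [smul_mulVec, one_mulVec, dotProduct_smul, smul_eq_mul]
  · simp

/-- The quartic Fierz identity `(ψ̄ Γ^a ψ) (ψ̄ Γ_{ab} ψ) = 0`. -/
theorem sum_spinorForm_Gam_mul (ψ : SpinorIdx → ℝ) (b : Fin 11) :
    ∑ a, mink a * spinorForm ψ (Gam a) * spinorForm ψ (Gam a * Gam b) = 0 := by
  obtain ⟨p1, p2, p3, p4, p5, p6, p7, p8, p9⟩ := pauli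
  have m0 : mink 0 = -1 := by simp [mink]
  have ms (i : Fin 10) : mink i.succ = 1 := by simp [mink]
  -- The spinor is a pair `(u, v)` of vectors in `ℝ^16`. Every product of at most two Clifford
  -- generators is, up to sign, of the form `M ⊗ E` with `E` one of `sE`, `sX`, `sZ`, `1`; the next
  -- facts evaluate the form on these four types.
  obtain ⟨u, hu⟩ : ∃ u : HalfIdx → ℝ, u = fun i => ψ (spinorSplit.symm (i, 0)) := ⟨_, rfl⟩
  obtain ⟨v, hv⟩ : ∃ v : HalfIdx → ℝ, v = fun i => ψ (spinorSplit.symm (i, 1)) := ⟨_, rfl⟩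
  have hE (M : Matrix HalfIdx HalfIdx ℝ) : spinorForm ψ (kronHalf M sE)
      = -(u ⬝ᵥ M *ᵥ u + v ⬝ᵥ M *ᵥ v) := by
    rw [spinorForm_kronHalf, p3, hu, hv]; simp; ring
  have hX (M : Matrix HalfIdx HalfIdx ℝ) : spinorForm ψ (kronHalf M sX)
      = u ⬝ᵥ M *ᵥ u - v ⬝ᵥ M *ᵥ v := by
    rw [spinorForm_kronHalf, p7, hu, hv]; simp [sZ]; ring
  have hZ (M : Matrix HalfIdx HalfIdx ℝ) : spinorForm ψ (kronHalf M sZ)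
      = -(u ⬝ᵥ M *ᵥ v + v ⬝ᵥ M *ᵥ u) := by
    rw [spinorForm_kronHalf, p9, hu, hv]; simp [sX]; ring
  have h1 (M : Matrix HalfIdx HalfIdx ℝ) : spinorForm ψ (kronHalf M 1)
      = u ⬝ᵥ M *ᵥ v - v ⬝ᵥ M *ᵥ u := by
    rw [spinorForm_kronHalf, mul_one, hu, hv]; simp [sE]; ring
  have hneg (M : Matrix HalfIdx HalfIdx ℝ) (E : M₂) : spinorForm ψ (kronHalf M (-E))
      = -spinorForm ψ (kronHalf M E) := by
    simp only [spinorForm_kronHalf, mul_neg, Matrix.neg_apply, neg_mul, Finset.sum_neg_distrib]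
  have kuv := sum_gam_polarized u v
  have kvu := sum_gam_polarized v u
  have kuu := sum_gam_polarized u u
  have kvv := sum_gam_polarized v v
  have hc := dotProduct_comm v u
  rw [Fin.sum_univ_succ, Fin.sum_univ_castSucc]
  rcases Fin.eq_zero_or_eq_succ b with rfl | ⟨b, rfl⟩
  · simp only [Gam_zero, Gam_castSucc_succ, Gam_last, kronHalf_mul, one_mul, mul_one, p3, p6, p8,
      hneg, hE, hX, hZ, h1, m0, ms, one_mulVec]
    have e : ∑ i, (u ⬝ᵥ gam i *ᵥ u - v ⬝ᵥ gam i *ᵥ v) * - -(u ⬝ᵥ gam i *ᵥ v + v ⬝ᵥ gam i *ᵥ u)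
        = 2 * ∑ i, (u ⬝ᵥ gam i *ᵥ u) * (u ⬝ᵥ gam i *ᵥ v)
          - 2 * ∑ i, (v ⬝ᵥ gam i *ᵥ v) * (v ⬝ᵥ gam i *ᵥ u) := by
      rw [Finset.mul_sum, Finset.mul_sum, ← Finset.sum_sub_distrib]
      refine Finset.sum_congr rfl fun i _ => ?_
      rw [dotProduct_gam_comm i v u]
      ring
    rw [e, kuv, kvu, hc]
    ring
  · rcases Fin.eq_castSucc_or_eq_last b with ⟨j, rfl⟩ | rfl
    · simp only [Gam_zero, Gam_castSucc_succ, Gam_last, kronHalf_mul, one_mul, p1, p5,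
        p7, hE, hX, hZ, h1, m0, ms, one_mulVec]
      -- After the swap the sums have the shape of `sum_gam_polarized` with second argument `γ_j v`
      -- or `γ_j u`. They cancel against the term `a = 0`, and the Clifford correction at `i = j`
      -- against `a = 10`.
      have e : ∑ i, (u ⬝ᵥ gam i *ᵥ u - v ⬝ᵥ gam i *ᵥ v)
            * (u ⬝ᵥ (gam i * gam j) *ᵥ v - v ⬝ᵥ (gam i * gam j) *ᵥ u)
          = 2 * ∑ i, (u ⬝ᵥ gam i *ᵥ u) * (u ⬝ᵥ gam i *ᵥ (gam j *ᵥ v))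
            + 2 * ∑ i, (v ⬝ᵥ gam i *ᵥ v) * (v ⬝ᵥ gam i *ᵥ (gam j *ᵥ u))
            - ∑ i, if i = j then 2 * (u ⬝ᵥ v) * (u ⬝ᵥ gam i *ᵥ u + v ⬝ᵥ gam i *ᵥ v) else 0 := by
        rw [Finset.mul_sum, Finset.mul_sum, ← Finset.sum_add_distrib, ← Finset.sum_sub_distrib]
        refine Finset.sum_congr rfl fun i _ => ?_
        rw [mulVec_mulVec, mulVec_mulVec, gam_mul_swap i j u v]
        split_ifs <;> ring
      rw [e, sum_gam_polarized, sum_gam_polarized, hc, dotProduct_gam_comm j v u]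
      simp only [Finset.sum_ite_eq', Finset.mem_univ, if_true]
      ring
    · simp only [Gam_zero, Gam_castSucc_succ, Gam_last, kronHalf_mul, one_mul, mul_one, p2, p4,
        p9, hneg, hE, hX, hZ, h1, m0, ms, one_mulVec]
      have e : ∑ i, (u ⬝ᵥ gam i *ᵥ u - v ⬝ᵥ gam i *ᵥ v)
            * - -(u ⬝ᵥ gam i *ᵥ u + v ⬝ᵥ gam i *ᵥ v)
          = ∑ i, (u ⬝ᵥ gam i *ᵥ u) * (u ⬝ᵥ gam i *ᵥ u)
            - ∑ i, (v ⬝ᵥ gam i *ᵥ v) * (v ⬝ᵥ gam i *ᵥ v) := by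
        rw [← Finset.sum_sub_distrib]
        exact Finset.sum_congr rfl fun i _ => by ring
      rw [e, kuu, kvv, hc]
      ring

/-! ### Spinor bilinears of products of Clifford generators -/

/-- The adjoint with respect to the spinor pairing. -/
def spinorAdj (M : Matrix SpinorIdx SpinorIdx ℝ) : Matrix SpinorIdx SpinorIdx ℝ :=
  -(spinorMetric * Mᵀ * spinorMetric)

theorem spinorMetric_sq : spinorMetric * spinorMetric = -1 := by
  have h := Gam_clifford 0 0
  rw [if_pos rfl, ← two_smul ℝ] at h
  have h2 := congrArg (fun M => (2⁻¹ : ℝ) • M) h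
  simpa [smul_smul, mink, spinorMetric] using h2

theorem spinorMetric_mul_adj (M : Matrix SpinorIdx SpinorIdx ℝ) :
    spinorMetric * spinorAdj M = Mᵀ * spinorMetric := by
  rw [spinorAdj, mul_neg, ← mul_assoc, ← mul_assoc, spinorMetric_sq]
  simp

theorem spinorAdj_mul (M N : Matrix SpinorIdx SpinorIdx ℝ) :
    spinorAdj (M * N) = spinorAdj N * spinorAdj M := by
  have h : spinorMetric * Nᵀ * spinorMetric * (spinorMetric * Mᵀ * spinorMetric)
      = spinorMetric * Nᵀ * (spinorMetric * spinorMetric) * Mᵀ * spinorMetric := by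
    noncomm_ring
  rw [spinorAdj, spinorAdj, spinorAdj, neg_mul_neg, h, spinorMetric_sq, transpose_mul]
  noncomm_ring

theorem spinorAdj_Gam (a : Fin 11) : spinorAdj (Gam a) = -Gam a := by
  rw [spinorAdj, mul_assoc, Gam_skewAdjoint, mul_neg, ← mul_assoc, spinorMetric_sq]
  simp

theorem spinorAdj_one : spinorAdj 1 = 1 := by
  rw [spinorAdj, transpose_one, mul_one, spinorMetric_sq, neg_neg]

/-- The components of the Minkowski metric. -/
def minkMetric (a b : Fin 11) : ℝ := if a = b then mink a else 0

theorem Gam_mul_swap (a b : Fin 11) :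
    Gam a * Gam b = (2 * minkMetric a b) • 1 - Gam b * Gam a := by
  rw [eq_sub_iff_add_eq, Gam_clifford, minkMetric]
  split_ifs <;> simp

theorem Gam_mul_swap_of_ne {a b : Fin 11} (h : a ≠ b) : Gam a * Gam b = -(Gam b * Gam a) := by
  rw [Gam_mul_swap, minkMetric, if_neg h]; simp

theorem Gam_mul_swap_of_ne_assoc {a b : Fin 11} (h : a ≠ b) (M : Matrix SpinorIdx SpinorIdx ℝ) :
    Gam a * (Gam b * M) = -(Gam b * (Gam a * M)) := by
  rw [← mul_assoc, Gam_mul_swap_of_ne h, neg_mul, mul_assoc]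

theorem Gam_mul_swap_assoc (a b : Fin 11) (M : Matrix SpinorIdx SpinorIdx ℝ) :
    Gam a * (Gam b * M) = (2 * minkMetric a b) • M - Gam b * (Gam a * M) := by
  rw [← mul_assoc, Gam_mul_swap, sub_mul, smul_mul_assoc, one_mul, mul_assoc]

theorem minkMetric_comm (a b : Fin 11) : minkMetric a b = minkMetric b a := by
  rcases eq_or_ne a b with rfl | h
  · rfl
  · rw [minkMetric, minkMetric, if_neg h, if_neg h.symm]

theorem Gam_reverse {a b c : Fin 11} (hab : a ≠ b) (hac : a ≠ c) (hbc : b ≠ c) :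
    Gam c * (Gam b * Gam a) = -(Gam a * (Gam b * Gam c)) := by
  rw [Gam_mul_swap_of_ne hab.symm, mul_neg, Gam_mul_swap_of_ne_assoc hac.symm,
    Gam_mul_swap_of_ne hbc.symm, mul_neg, neg_neg]

section Form

variable {V : Type*} [AddCommGroup V] [Module ℝ V] {q : Matrix SpinorIdx SpinorIdx ℝ →ₗ[ℝ] V}

/-- The linear map `q` is kept abstract since the bilinears are used twice: evaluated at a real
spinor (`spinorFormLin`) and inside the graded algebra (`bilinLin`). -/
theorem form_eq_zero_of_adj (hq : ∀ M, q (spinorAdj M) = -q M)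
    {M : Matrix SpinorIdx SpinorIdx ℝ} (h : spinorAdj M = M) :
    q M = 0 := by
  have h1 := hq M
  rw [h] at h1
  have h2 : (2 : ℝ) • q M = 0 := by rw [two_smul]; nth_rewrite 1 [h1]; exact neg_add_cancel _
  exact (smul_eq_zero.mp h2).resolve_left two_ne_zero

theorem form_one (hq : ∀ M, q (spinorAdj M) = -q M) : q 1 = 0 :=
  form_eq_zero_of_adj hq spinorAdj_one

theorem form_two_swap (hq : ∀ M, q (spinorAdj M) = -q M)
    (a b : Fin 11) : q (Gam a * Gam b) = -q (Gam b * Gam a) := by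
  rw [Gam_mul_swap, map_sub, map_smul, form_one hq, smul_zero, zero_sub]

/-- The adjoint gives three signs and reverses the order; reversing three anticommuting generators
gives one more sign, so the product is self-adjoint. -/
theorem form_three (hq : ∀ M, q (spinorAdj M) = -q M)
    {a b c : Fin 11} (hab : a ≠ b) (hac : a ≠ c) (hbc : b ≠ c) :
    q (Gam a * (Gam b * Gam c)) = 0 := by
  refine form_eq_zero_of_adj hq ?_
  simp only [spinorAdj_mul, spinorAdj_Gam, neg_mul, mul_neg, neg_neg]
  rw [mul_assoc, Gam_reverse hab hac hbc, neg_neg]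

/-- The adjoint reverses the product with total sign `+`. Restoring the order moves `Γ_a` past the
others, which are distinct and merely anticommute, so only metric terms appear; `q` being odd under
the adjoint then determines twice the left side. Here `a` may coincide with `b`, `c` or `d`. -/
theorem form_four (hq : ∀ M, q (spinorAdj M) = -q M)
    (a : Fin 11) {b c d : Fin 11} (hbc : b ≠ c) (hbd : b ≠ d) (hcd : c ≠ d) :
    q (Gam a * (Gam b * (Gam c * Gam d))) = minkMetric a b • q (Gam c * Gam d)
      - minkMetric a c • q (Gam b * Gam d) + minkMetric a d • q (Gam b * Gam c) := by
  have h := hq (Gam a * (Gam b * (Gam c * Gam d)))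
  have e : spinorAdj (Gam a * (Gam b * (Gam c * Gam d)))
      = Gam a * (Gam b * (Gam c * Gam d)) + (2 * minkMetric a d) • (Gam c * Gam b)
        - (2 * minkMetric a c) • (Gam d * Gam b) + (2 * minkMetric a b) • (Gam d * Gam c) := by
    simp only [spinorAdj_mul, spinorAdj_Gam, neg_mul, mul_neg, neg_neg, mul_assoc]
    have e1 : Gam c * (Gam b * Gam a)
        = (2 * minkMetric a b) • Gam c - (2 * minkMetric a c) • Gam b
          + Gam a * (Gam c * Gam b) := by
      rw [Gam_mul_swap b a, mul_sub, Gam_mul_swap_assoc c a, minkMetric_comm b, minkMetric_comm c,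
        mul_smul_comm, mul_one]
      module
    rw [e1, mul_add, mul_sub, Gam_mul_swap_assoc d a, Gam_reverse hbc hbd hcd, minkMetric_comm d,
      mul_smul_comm, mul_smul_comm, mul_neg]
    module
  rw [e] at h
  simp only [map_add, map_sub, map_smul, form_two_swap hq c b, form_two_swap hq d b,
    form_two_swap hq d c] at h
  have h2 : (2 : ℝ) • q (Gam a * (Gam b * (Gam c * Gam d))) = (2 : ℝ) •
      (minkMetric a b • q (Gam c * Gam d)
      - minkMetric a c • q (Gam b * Gam d) + minkMetric a d • q (Gam b * Gam c)) := by
    rw [two_smul, ← sub_eq_zero]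
    rw [← sub_eq_zero] at h
    rw [← h]
    module
  exact smul_right_injective V (two_ne_zero (α := ℝ)) h2

/-- Adjacent generators anticommute under `q` if it vanishes on the remaining factors. -/
theorem form_swap_of_eq_zero (M N : Matrix SpinorIdx SpinorIdx ℝ) (x y : Fin 11)
    (h : q (M * N) = 0) :
    q (M * (Gam y * (Gam x * N))) = -q (M * (Gam x * (Gam y * N))) := by
  rw [Gam_mul_swap_assoc, mul_sub, map_sub, mul_smul_comm, map_smul, h, smul_zero, zero_sub]

end Form

/-! ### Fierz identities for real spinors -/

/-- The spinor bilinear as a linear form in the matrix. -/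
def spinorFormLin (ψ : SpinorIdx → ℝ) : Matrix SpinorIdx SpinorIdx ℝ →ₗ[ℝ] ℝ where
  toFun := spinorForm ψ
  map_add' M N := by simp [spinorForm, mul_add, add_mulVec]
  map_smul' r M := by simp [spinorForm, smul_mulVec]

theorem spinorFormLin_adj (ψ : SpinorIdx → ℝ) (M : Matrix SpinorIdx SpinorIdx ℝ) :
    spinorFormLin ψ (spinorAdj M) = -spinorFormLin ψ M := by
  change spinorForm ψ _ = -spinorForm ψ _
  rw [spinorForm, spinorMetric_mul_adj, spinorForm, dotProduct_mulVec, ← mulVec_transpose,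
    transpose_mul, transpose_transpose, spinorMetric_skew, dotProduct_comm, neg_mul, neg_mulVec,
    dotProduct_neg]

/-- The left side is the coefficient of `t` in the form of `M` at `ψ + t N ψ`; passing to the
adjoint of `N` turns it into bilinears of `ψ` alone. -/
theorem dotProduct_spinorMetric_mulVec (ψ : SpinorIdx → ℝ) (M N : Matrix SpinorIdx SpinorIdx ℝ) :
    ψ ⬝ᵥ (spinorMetric * M) *ᵥ (N *ᵥ ψ) + (N *ᵥ ψ) ⬝ᵥ (spinorMetric * M) *ᵥ ψ
      = spinorForm ψ (M * N) + spinorForm ψ (spinorAdj N * M) := by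
  rw [mulVec_mulVec, mul_assoc]
  refine congrArg (spinorForm ψ (M * N) + ·) ?_
  rw [spinorForm, ← mul_assoc, spinorMetric_mul_adj, mul_assoc, ← mulVec_mulVec _ Nᵀ,
    dotProduct_mulVec _ Nᵀ, vecMul_transpose]

theorem sum_minkMetric_mul (c : Fin 11) (f : Fin 11 → ℝ) :
    ∑ a, mink a * minkMetric a c * f a = f c := by
  have h (a : Fin 11) : mink a * minkMetric a c * f a = if a = c then f a else 0 := by
    have : mink a * mink a = 1 := by rw [mink]; split_ifs <;> norm_num
    rw [minkMetric]
    split_ifs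
    · rw [this, one_mul]
    · simp
  simp [h]

/-- The quartic Fierz identity `(ψ̄ Γ^a ψ) (ψ̄ Γ_{abcde} ψ) = 3 (ψ̄ Γ_{[bc} ψ) (ψ̄ Γ_{de]} ψ)`. -/
theorem sum_spinorForm_Gam_mul_five (ψ : SpinorIdx → ℝ) (b : Fin 11) {c d e : Fin 11}
    (hcd : c ≠ d) (hce : c ≠ e) (hde : d ≠ e) :
    ∑ a, mink a * spinorForm ψ (Gam a)
        * spinorForm ψ (Gam a * (Gam b * (Gam c * (Gam d * Gam e)))) =
      spinorForm ψ (Gam b * Gam c) * spinorForm ψ (Gam d * Gam e)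
      - spinorForm ψ (Gam b * Gam d) * spinorForm ψ (Gam c * Gam e)
      + spinorForm ψ (Gam b * Gam e) * spinorForm ψ (Gam c * Gam d) := by
  have hq := spinorFormLin_adj ψ
  obtain ⟨N, hN⟩ : ∃ N, N = Gam c * (Gam d * Gam e) := ⟨_, rfl⟩
  have hN0 : spinorForm ψ N = 0 := by rw [hN]; exact form_three hq hcd hce hde
  -- By `h1` and `h2` the two bilinears in each linear coefficient agree, which is the source of the
  -- factors 2 in `h5`.
  have h1 (a : Fin 11) : spinorForm ψ (spinorAdj N * Gam a) = spinorForm ψ (Gam a * N) := by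
    have h : spinorForm ψ (spinorAdj (Gam a * N)) = -spinorForm ψ (Gam a * N) := hq _
    rw [spinorAdj_mul, spinorAdj_Gam, mul_neg] at h
    exact neg_injective (((spinorFormLin ψ).map_neg _).symm.trans h)
  have h2 (a : Fin 11) : spinorForm ψ (spinorAdj N * (Gam a * Gam b))
      = spinorForm ψ (Gam a * (Gam b * N)) := by
    have h : spinorForm ψ (spinorAdj (Gam b * (Gam a * N))) = -spinorForm ψ (Gam b * (Gam a * N)) :=
      hq _
    have h' : spinorForm ψ (Gam b * (Gam a * N)) = -spinorForm ψ (Gam a * (Gam b * N)) := by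
      have := form_swap_of_eq_zero (q := spinorFormLin ψ) 1 N a b (by rw [one_mul]; exact hN0)
      rw [one_mul, one_mul] at this
      exact this
    rw [h', spinorAdj_mul, spinorAdj_mul, spinorAdj_Gam, spinorAdj_Gam, mul_assoc,
      neg_mul_neg, neg_neg] at h
    exact h
  -- The quartic identity with two gammas holds at `ψ + t N ψ` for all `t`. In its linear
  -- coefficient one part has four gammas against two, where `form_four` contracts `a` with `c`,
  -- `d`, `e`; the other part is the desired sum.
  have key := sum_linear_coeff_eq_zero (fun a => mink a * spinorForm ψ (Gam a))
    (fun a => mink a * (ψ ⬝ᵥ (spinorMetric * Gam a) *ᵥ (N *ᵥ ψ)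
      + (N *ᵥ ψ) ⬝ᵥ (spinorMetric * Gam a) *ᵥ ψ))
    (fun a => mink a * spinorForm (N *ᵥ ψ) (Gam a))
    (fun a => spinorForm ψ (Gam a * Gam b))
    (fun a => ψ ⬝ᵥ (spinorMetric * (Gam a * Gam b)) *ᵥ (N *ᵥ ψ)
      + (N *ᵥ ψ) ⬝ᵥ (spinorMetric * (Gam a * Gam b)) *ᵥ ψ)
    (fun a => spinorForm (N *ᵥ ψ) (Gam a * Gam b)) (fun t => by
      rw [← sum_spinorForm_Gam_mul (ψ + t • N *ᵥ ψ) b]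
      refine Finset.sum_congr rfl fun a _ => ?_
      simp only [spinorForm, dotProduct_mulVec_add_smul]
      ring)
  simp only [dotProduct_spinorMetric_mulVec, h1, h2, mul_assoc] at key
  have h4 (a : Fin 11) : spinorForm ψ (Gam a * N)
      = minkMetric a c * spinorForm ψ (Gam d * Gam e)
        - minkMetric a d * spinorForm ψ (Gam c * Gam e)
        + minkMetric a e * spinorForm ψ (Gam c * Gam d) := by
    rw [hN]; exact form_four hq a hcd hce hde
  have hs (x y : Fin 11) : spinorForm ψ (Gam x * Gam y) = -spinorForm ψ (Gam y * Gam x) :=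
    form_two_swap hq x y
  have s1 := sum_minkMetric_mul c fun a =>
    spinorForm ψ (Gam d * Gam e) * spinorForm ψ (Gam a * Gam b)
  have s2 := sum_minkMetric_mul d fun a =>
    spinorForm ψ (Gam c * Gam e) * spinorForm ψ (Gam a * Gam b)
  have s3 := sum_minkMetric_mul e fun a =>
    spinorForm ψ (Gam c * Gam d) * spinorForm ψ (Gam a * Gam b)
  have h5 : (0 : ℝ) = 2 * ∑ a, (mink a * minkMetric a c *
        (spinorForm ψ (Gam d * Gam e) * spinorForm ψ (Gam a * Gam b)))
      - 2 * ∑ a, (mink a * minkMetric a d *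
        (spinorForm ψ (Gam c * Gam e) * spinorForm ψ (Gam a * Gam b)))
      + 2 * ∑ a, (mink a * minkMetric a e *
        (spinorForm ψ (Gam c * Gam d) * spinorForm ψ (Gam a * Gam b)))
      + 2 * ∑ a, mink a * spinorForm ψ (Gam a) * spinorForm ψ (Gam a * (Gam b * N)) := by
    rw [← key]
    simp only [Finset.mul_sum, ← Finset.sum_add_distrib, ← Finset.sum_sub_distrib]
    refine Finset.sum_congr rfl fun a _ => ?_
    rw [h4 a]
    ring
  rw [s1, s2, s3, hN, hs c b, hs d b, hs e b] at h5
  linarith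

end SuperLInfty

namespace SuperLInfty

open GCA Matrix

/-! ### Polynomials in the fermionic generators -/

theorem psi_comm (α β : SpinorIdx) : psi α * psi β = psi β * psi α := by
  have h := gen_mul_gen (deg := minkDeg) (.psi α) (.psi β)
  have e : koszul (minkDeg (.psi α)) (minkDeg (.psi β)) = 1 := by
    simp [koszul, minkDeg, ZMod.val_one]
  rwa [e, one_smul] at h

open scoped IsMulCommutative in
/-- The algebra map from polynomials to the subalgebra generated by the commuting `ψ^α`. -/
def psiPoly : MvPolynomial SpinorIdx ℝ →ₐ[ℝ] GCA minkDeg :=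
  haveI : IsMulCommutative (Algebra.adjoin ℝ (Set.range psi)) :=
    Algebra.isMulCommutative_adjoin ℝ (by
      rintro _ ⟨α, rfl⟩ _ ⟨β, rfl⟩
      exact psi_comm α β)
  (Algebra.adjoin ℝ (Set.range psi)).val.comp
    (MvPolynomial.aeval fun α => ⟨psi α, Algebra.subset_adjoin ⟨α, rfl⟩⟩)

theorem psiPoly_X (α : SpinorIdx) : psiPoly (MvPolynomial.X α) = psi α := by
  simp [psiPoly]

/-- The spinor bilinear as a polynomial. -/
def bilinPoly (M : Matrix SpinorIdx SpinorIdx ℝ) : MvPolynomial SpinorIdx ℝ :=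
  ∑ α, ∑ γ, (spinorMetric * M) α γ • (MvPolynomial.X α * MvPolynomial.X γ)

theorem psiPoly_bilinPoly (M : Matrix SpinorIdx SpinorIdx ℝ) : psiPoly (bilinPoly M) = bilin M := by
  simp only [bilinPoly, map_sum, map_smul, map_mul, psiPoly_X, bilin]

theorem eval_bilinPoly (ψ : SpinorIdx → ℝ) (M : Matrix SpinorIdx SpinorIdx ℝ) :
    MvPolynomial.eval ψ (bilinPoly M) = spinorForm ψ M := by
  simp only [bilinPoly, map_sum, MvPolynomial.smul_eval, map_mul, MvPolynomial.eval_X, spinorForm,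
    dotProduct, mulVec, Finset.mul_sum]
  exact Finset.sum_congr rfl fun α _ => Finset.sum_congr rfl fun γ _ => by ring

/-- The spinor bilinear `(ψ̄ M ψ)` as a linear map in `M`. -/
def bilinLin : Matrix SpinorIdx SpinorIdx ℝ →ₗ[ℝ] GCA minkDeg where
  toFun := bilin
  map_add' M N := by
    simp only [bilin, mul_add, Matrix.add_apply, add_smul, Finset.sum_add_distrib]
  map_smul' r M := by
    simp only [bilin, mul_smul_comm, Matrix.smul_apply, smul_assoc, Finset.smul_sum,
      RingHom.id_apply]

theorem bilinLin_adj (M : Matrix SpinorIdx SpinorIdx ℝ) :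
    bilinLin (spinorAdj M) = -bilinLin M := by
  change bilin _ = -bilin _
  rw [← psiPoly_bilinPoly, ← psiPoly_bilinPoly, ← map_neg]
  refine congrArg psiPoly (MvPolynomial.funext fun ψ => ?_)
  rw [map_neg, eval_bilinPoly, eval_bilinPoly]
  exact spinorFormLin_adj ψ M

/-- The `ψ^α` commute, so the bilinears are images of polynomials under `psiPoly`, and a real
polynomial vanishing at all real spinors is zero. Fierz identities for real spinors thus transfer to
the graded algebra. -/
theorem sum_bilin_Gam_mul (b : Fin 11) :
    ∑ a, bilin (mink a • Gam a) * bilin (Gam a * Gam b) = 0 := by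
  have h : ∑ a, bilinPoly (mink a • Gam a) * bilinPoly (Gam a * Gam b) = 0 := by
    refine MvPolynomial.funext fun ψ => ?_
    simp only [map_sum, map_mul, eval_bilinPoly, map_zero]
    rw [← sum_spinorForm_Gam_mul ψ b]
    exact Finset.sum_congr rfl fun a _ =>
      congrArg (· * _) ((spinorFormLin ψ).map_smul (mink a) (Gam a))
  have := congrArg psiPoly h
  simpa only [map_sum, map_mul, psiPoly_bilinPoly, map_zero] using this

theorem sum_bilin_Gam_mul_five (b : Fin 11) {c d e : Fin 11}
    (hcd : c ≠ d) (hce : c ≠ e) (hde : d ≠ e) :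
    ∑ a, bilin (mink a • Gam a) * bilin (Gam a * (Gam b * (Gam c * (Gam d * Gam e)))) =
      bilin (Gam b * Gam c) * bilin (Gam d * Gam e)
      - bilin (Gam b * Gam d) * bilin (Gam c * Gam e)
      + bilin (Gam b * Gam e) * bilin (Gam c * Gam d) := by
  have h : ∑ a, bilinPoly (mink a • Gam a)
        * bilinPoly (Gam a * (Gam b * (Gam c * (Gam d * Gam e)))) =
      bilinPoly (Gam b * Gam c) * bilinPoly (Gam d * Gam e)
      - bilinPoly (Gam b * Gam d) * bilinPoly (Gam c * Gam e)
      + bilinPoly (Gam b * Gam e) * bilinPoly (Gam c * Gam d) := by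
    refine MvPolynomial.funext fun ψ => ?_
    simp only [map_sum, map_mul, map_add, map_sub, eval_bilinPoly]
    rw [← sum_spinorForm_Gam_mul_five ψ b hcd hce hde]
    exact Finset.sum_congr rfl fun a _ =>
      congrArg (· * _) ((spinorFormLin ψ).map_smul (mink a) (Gam a))
  have := congrArg psiPoly h
  simpa only [map_sum, map_mul, map_add, map_sub, psiPoly_bilinPoly] using this

/-! ### Products of the bosonic generators -/

/-- The algebra map from the exterior algebra to the subalgebra generated by the `e^a`. -/
def vielbExt : ExteriorAlgebra ℝ (Fin 11 → ℝ) →ₐ[ℝ] GCA minkDeg :=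
  ExteriorAlgebra.lift ℝ ⟨Fintype.linearCombination ℝ vielb, fun v => by
    refine mul_self_of_mem_odd odd_one ?_
    rw [Fintype.linearCombination_apply]
    exact Submodule.sum_mem _ fun a _ => Submodule.smul_mem _ _ (vielb_mem a)⟩

theorem vielbExt_ιMulti {n : ℕ} (a : Fin n → Fin 11) :
    vielbExt (ExteriorAlgebra.ιMulti ℝ n fun i => Pi.single (a i) 1) =
      (List.ofFn fun i => vielb (a i)).prod := by
  rw [ExteriorAlgebra.ιMulti_apply, map_list_prod, List.map_ofFn]
  congr 2
  funext i
  simp [vielbExt, Fintype.linearCombination_apply_single]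

theorem vielb_prod_perm {n : ℕ} (a : Fin n → Fin 11) (σ : Equiv.Perm (Fin n)) :
    (List.ofFn fun i => vielb (a (σ i))).prod =
      ((Equiv.Perm.sign σ : ℤ) : ℝ) • (List.ofFn fun i => vielb (a i)).prod := by
  have h := AlternatingMap.map_perm (ExteriorAlgebra.ιMulti ℝ n)
    (fun i => (Pi.single (a i) 1 : Fin 11 → ℝ)) σ
  have h2 := congrArg vielbExt h
  rw [Units.smul_def, ← Int.cast_smul_eq_zsmul ℝ, map_smul, vielbExt_ιMulti] at h2
  exact (vielbExt_ιMulti fun i => a (σ i)).symm.trans h2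

theorem vielb_prod_eq_zero {n : ℕ} (a : Fin n → Fin 11) {i j : Fin n} (hij : i ≠ j)
    (h : a i = a j) : (List.ofFn fun i => vielb (a i)).prod = 0 := by
  rw [← vielbExt_ιMulti, AlternatingMap.map_eq_zero_of_eq _ _ (by simp only [h]) hij, map_zero]

/-- Contracting with `e^{a_1} ⋯ e^{a_k}` makes skew-symmetrization redundant. -/
theorem sum_bilin_GamSkew (n : ℕ) :
    ∑ a : Fin n → Fin 11, bilin (GamSkew a) * (List.ofFn fun i => vielb (a i)).prod =
      ∑ a : Fin n → Fin 11, bilin (List.ofFn fun i => Gam (a i)).prod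
        * (List.ofFn fun i => vielb (a i)).prod := by
  -- The sign of `σ` is absorbed by reordering the anticommuting `e^a`. Each of the `n!`
  -- permutations then contributes the same sum after re-indexing.
  have h (a : Fin n → Fin 11) : bilin (GamSkew a) * (List.ofFn fun i => vielb (a i)).prod =
      (n.factorial : ℝ)⁻¹ • ∑ σ : Equiv.Perm (Fin n),
        bilin (List.ofFn fun i => Gam (a (σ i))).prod
          * (List.ofFn fun i => vielb (a (σ i))).prod := by
    change bilinLin (GamSkew a) * _ = _
    rw [GamSkew, map_smul, map_sum, smul_mul_assoc, Finset.sum_mul]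
    refine congrArg _ (Finset.sum_congr rfl fun σ _ => ?_)
    rw [map_smul, vielb_prod_perm, smul_mul_assoc, mul_smul_comm]
    rfl
  simp only [h]
  rw [← Finset.smul_sum, Finset.sum_comm]
  have h2 (σ : Equiv.Perm (Fin n)) : ∑ a : Fin n → Fin 11,
      bilin (List.ofFn fun i => Gam (a (σ i))).prod * (List.ofFn fun i => vielb (a (σ i))).prod
      = ∑ a : Fin n → Fin 11, bilin (List.ofFn fun i => Gam (a i)).prod
        * (List.ofFn fun i => vielb (a i)).prod :=
    Equiv.sum_comp (Equiv.arrowCongr σ.symm (Equiv.refl (Fin 11))) fun a : Fin n → Fin 11 =>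
      bilin (List.ofFn fun i => Gam (a i)).prod * (List.ofFn fun i => vielb (a i)).prod
  simp only [h2, Finset.sum_const, Finset.card_univ, Fintype.card_perm, Fintype.card_fin]
  rw [← Nat.cast_smul_eq_nsmul ℝ, smul_smul, inv_mul_cancel₀ (Nat.cast_ne_zero.mpr
    (Nat.factorial_ne_zero n)), one_smul]

theorem sum_fin_succ_fun {n : ℕ} (f : (Fin (n + 1) → Fin 11) → GCA minkDeg) :
    ∑ a, f a = ∑ x, ∑ b : Fin n → Fin 11, f (Matrix.vecCons x b) := by
  rw [← Fintype.sum_prod_type' (f := fun x (b : Fin n → Fin 11) => f (Matrix.vecCons x b))]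
  exact (Equiv.sum_comp (Fin.consEquiv fun _ => Fin 11) f).symm

theorem G4_eq : G4 = (1 / 2 : ℝ) • ∑ x, ∑ y, bilin (Gam x * Gam y) * (vielb x * vielb y) := by
  rw [G4, sum_bilin_GamSkew]
  simp [sum_fin_succ_fun]

theorem G7_eq : G7 = (1 / 120 : ℝ) • ∑ x, ∑ y, ∑ z, ∑ u, ∑ w,
    bilin (Gam x * (Gam y * (Gam z * (Gam u * Gam w))))
      * (vielb x * (vielb y * (vielb z * (vielb u * vielb w)))) := by
  rw [G7, sum_bilin_GamSkew]
  simp [sum_fin_succ_fun, Nat.factorial]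

end SuperLInfty

namespace SuperLInfty

open GCA Matrix

/-! ### Differentials on super-Minkowski spacetime -/

theorem bilin_comm (M : Matrix SpinorIdx SpinorIdx ℝ) (x : GCA minkDeg) :
    bilin M * x = x * bilin M :=
  commute_of_mem_even ⟨1, by norm_num⟩ (bilin_mem M) x

theorem d_psi (α : SpinorIdx) : superMink.d (psi α) = 0 := d_gen (g := superMink) (.psi α)

theorem d_vielb (a : Fin 11) : superMink.d (vielb a) = bilin (mink a • Gam a) :=
  d_gen (g := superMink) (.e a)

theorem d_bilin (M : Matrix SpinorIdx SpinorIdx ℝ) : superMink.d (bilin M) = 0 := by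
  rw [bilin, map_sum]
  refine Finset.sum_eq_zero fun α _ => ?_
  rw [map_sum]
  refine Finset.sum_eq_zero fun γ _ => ?_
  rw [map_smul, d_mul, d_psi, d_psi, zero_mul, mul_zero, add_zero, smul_zero]

theorem d_bilin_mul (M : Matrix SpinorIdx SpinorIdx ℝ) (x : GCA minkDeg) :
    superMink.d (bilin M * x) = bilin M * superMink.d x := by
  have h := d_mul_even (g := superMink) (k := 2) ⟨1, by norm_num⟩ (bilin_mem M) x
  rw [h, d_bilin, zero_mul, zero_add]

theorem d_vielb_mul (a : Fin 11) (x : GCA minkDeg) :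
    superMink.d (vielb a * x) = bilin (mink a • Gam a) * x - vielb a * superMink.d x := by
  have h := d_mul_odd (g := superMink) (k := 1) odd_one (vielb_mem a) x
  rw [h, d_vielb]

theorem superMink_isSuperLInfty : superMink.IsSuperLInfty := by
  refine isSuperLInfty_of_gen ?_
  rintro (α | a)
  · exact map_zero _
  · exact d_bilin _

theorem vielb_mul_bilin_mul (a : Fin 11) (M : Matrix SpinorIdx SpinorIdx ℝ) (x : GCA minkDeg) :
    vielb a * (bilin M * x) = bilin M * (vielb a * x) := by
  rw [← mul_assoc, ← bilin_comm, mul_assoc]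

theorem bilin_mul_swap (M N : Matrix SpinorIdx SpinorIdx ℝ) (x : GCA minkDeg) :
    bilin M * (bilin N * x) = bilin N * (bilin M * x) := by
  rw [← mul_assoc, bilin_comm M, mul_assoc]

theorem vielb_swap (a b : Fin 11) : vielb a * vielb b = -(vielb b * vielb a) := by
  have h := homog_comm (vielb_mem a) (vielb_mem b)
  rwa [koszul_odd _ odd_one, parity_odd odd_one, neg_one_smul] at h

theorem vielb_swap_mul (a b : Fin 11) (x : GCA minkDeg) :
    vielb a * (vielb b * x) = -(vielb b * (vielb a * x)) := by
  rw [← mul_assoc, vielb_swap, neg_mul, mul_assoc]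

/-- `G₄` is closed. -/
theorem d_G4 : superMink.d G4 = 0 := by
  -- For fixed `y`, the sum over `x` is the Fierz identity. The second Leibniz term, `h2`, is minus
  -- this one with `x` and `y` renamed.
  have h1 : ∑ x, ∑ y, bilin (Gam x * Gam y) * (bilin (mink x • Gam x) * vielb y) = 0 := by
    rw [Finset.sum_comm]
    refine Finset.sum_eq_zero fun y _ => ?_
    have := congrArg (· * vielb y) (sum_bilin_Gam_mul y)
    simp only [zero_mul, Finset.sum_mul] at this
    rw [← this]
    exact Finset.sum_congr rfl fun x _ => by rw [bilin_mul_swap, mul_assoc]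
  have h2 : ∑ x, ∑ y, bilin (Gam x * Gam y) * (bilin (mink y • Gam y) * vielb x) = 0 := by
    rw [Finset.sum_comm, ← neg_eq_zero, ← h1]
    simp only [← Finset.sum_neg_distrib]
    refine Finset.sum_congr rfl fun x _ => Finset.sum_congr rfl fun y _ => ?_
    have : bilin (Gam y * Gam x) = -bilin (Gam x * Gam y) := form_two_swap bilinLin_adj y x
    rw [this, neg_mul, neg_neg]
  have e : superMink.d G4 = (1 / 2 : ℝ) •
      (∑ x, ∑ y, bilin (Gam x * Gam y) * (bilin (mink x • Gam x) * vielb y)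
        - ∑ x, ∑ y, bilin (Gam x * Gam y) * (bilin (mink y • Gam y) * vielb x)) := by
    rw [G4_eq, map_smul, map_sum]
    simp only [map_sum, d_bilin_mul, d_vielb_mul, d_vielb, mul_sub, Finset.sum_sub_distrib,
      bilin_comm _ (vielb _)]
  rw [e, h1, h2, sub_zero, smul_zero]

/-- The product `e^p e^q e^r e^s`. -/
def vielb4 (p q r s : Fin 11) : GCA minkDeg := vielb p * (vielb q * (vielb r * vielb s))

/-- The gamma identities need distinct indices; in all other cases the product of the `e^a` vanishes
anyway. -/
theorem vielb4_eq_zero_or (p q r s : Fin 11) :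
    vielb4 p q r s = 0 ∨ (p ≠ q ∧ p ≠ r ∧ p ≠ s) ∧ (q ≠ r ∧ q ≠ s) ∧ r ≠ s := by
  have h : vielb4 p q r s = (List.ofFn fun i => vielb (![p, q, r, s] i)).prod := by
    simp [vielb4]
  by_contra! hc
  obtain ⟨h0, h1⟩ := hc
  refine h0 ?_
  rw [h]
  by_cases a1 : p = q
  · exact vielb_prod_eq_zero _ (i := 0) (j := 1) (by decide) a1
  by_cases a2 : p = r
  · exact vielb_prod_eq_zero _ (i := 0) (j := 2) (by decide) a2
  by_cases a3 : p = s
  · exact vielb_prod_eq_zero _ (i := 0) (j := 3) (by decide) a3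
  by_cases a4 : q = r
  · exact vielb_prod_eq_zero _ (i := 1) (j := 2) (by decide) a4
  by_cases a5 : q = s
  · exact vielb_prod_eq_zero _ (i := 1) (j := 3) (by decide) a5
  · exact vielb_prod_eq_zero _ (i := 2) (j := 3) (by decide) (h1 ⟨a1, a2, a3⟩ ⟨a4, a5⟩)

section Insertion

variable {x p q r s : Fin 11}

/-- Moving `Γ_x` past a neighbour costs a multiple of the bilinear of the three remaining distinct
generators, which is zero by `form_three`. So `Γ_x` moves to the front with signs only, even if `x`
equals one of the other indices. -/
theorem bilin_insert_one (h : (p ≠ q ∧ p ≠ r ∧ p ≠ s) ∧ (q ≠ r ∧ q ≠ s) ∧ r ≠ s) :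
    bilin (Gam p * (Gam x * (Gam q * (Gam r * Gam s)))) =
      -bilin (Gam x * (Gam p * (Gam q * (Gam r * Gam s)))) := by
  have := form_swap_of_eq_zero (q := bilinLin) 1 (Gam q * (Gam r * Gam s)) x p
    (by rw [one_mul]; exact form_three bilinLin_adj h.2.1.1 h.2.1.2 h.2.2)
  rw [one_mul, one_mul] at this
  exact this

theorem bilin_insert_two (h : (p ≠ q ∧ p ≠ r ∧ p ≠ s) ∧ (q ≠ r ∧ q ≠ s) ∧ r ≠ s) :
    bilin (Gam p * (Gam q * (Gam x * (Gam r * Gam s)))) =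
      bilin (Gam x * (Gam p * (Gam q * (Gam r * Gam s)))) := by
  have := form_swap_of_eq_zero (q := bilinLin) (Gam p) (Gam r * Gam s) x q
    (form_three bilinLin_adj h.1.2.1 h.1.2.2 h.2.2)
  exact this.trans (neg_eq_iff_eq_neg.mpr (bilin_insert_one h))

theorem bilin_insert_three (h : (p ≠ q ∧ p ≠ r ∧ p ≠ s) ∧ (q ≠ r ∧ q ≠ s) ∧ r ≠ s) :
    bilin (Gam p * (Gam q * (Gam r * (Gam x * Gam s)))) =
      -bilin (Gam x * (Gam p * (Gam q * (Gam r * Gam s)))) := by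
  have := form_swap_of_eq_zero (q := bilinLin) (Gam p * Gam q) (Gam s) x r
    (by rw [mul_assoc]; exact form_three bilinLin_adj h.1.1 h.1.2.2 h.2.1.2)
  rw [mul_assoc, mul_assoc] at this
  exact this.trans (congrArg Neg.neg (bilin_insert_two h))

theorem bilin_insert_four (h : (p ≠ q ∧ p ≠ r ∧ p ≠ s) ∧ (q ≠ r ∧ q ≠ s) ∧ r ≠ s) :
    bilin (Gam p * (Gam q * (Gam r * (Gam s * Gam x)))) =
      bilin (Gam x * (Gam p * (Gam q * (Gam r * Gam s)))) := by
  have := form_swap_of_eq_zero (q := bilinLin) (Gam p * (Gam q * Gam r)) 1 x s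
    (by rw [mul_one]; exact form_three bilinLin_adj h.1.1 h.1.2.1 h.2.1.1)
  simp only [mul_assoc, mul_one] at this
  exact this.trans (neg_eq_iff_eq_neg.mpr (bilin_insert_three h))

end Insertion

section Sums

variable {ι A : Type*} [Fintype ι] [AddCommMonoid A]

theorem sum_comm_three (f : ι → ι → ι → A) :
    ∑ x, ∑ p, ∑ q, f x p q = ∑ p, ∑ q, ∑ x, f x p q := by
  rw [Finset.sum_comm]
  exact Finset.sum_congr rfl fun p _ => Finset.sum_comm

theorem sum_comm_four (f : ι → ι → ι → ι → A) :
    ∑ x, ∑ p, ∑ q, ∑ r, f x p q r = ∑ p, ∑ q, ∑ r, ∑ x, f x p q r := by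
  rw [Finset.sum_comm]
  exact Finset.sum_congr rfl fun p _ => sum_comm_three fun x q r => f x p q r

theorem sum_comm_five (f : ι → ι → ι → ι → ι → A) :
    ∑ x, ∑ p, ∑ q, ∑ r, ∑ s, f x p q r s = ∑ p, ∑ q, ∑ r, ∑ s, ∑ x, f x p q r s := by
  rw [Finset.sum_comm]
  exact Finset.sum_congr rfl fun p _ => sum_comm_four fun x q r s => f x p q r s

end Sums

/-- The Leibniz rule gives five terms with alternating signs. Bringing the differentiated index to
the front of the gamma product gives the same alternating signs, so all five agree, and `5/120 =
1/24`. -/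
theorem d_G7_eq_sum : superMink.d G7 = (1 / 24 : ℝ) • ∑ p, ∑ q, ∑ r, ∑ s, ∑ x,
    bilin (mink x • Gam x) * bilin (Gam x * (Gam p * (Gam q * (Gam r * Gam s))))
      * vielb4 p q r s := by
  obtain ⟨B, hB⟩ : ∃ B : Fin 11 → Fin 11 → Fin 11 → Fin 11 → Fin 11 → GCA minkDeg,
    ∀ x p q r s, B x p q r s = bilin (Gam x * (Gam p * (Gam q * (Gam r * Gam s)))) :=
    ⟨_, fun _ _ _ _ _ => rfl⟩
  obtain ⟨V, hV⟩ : ∃ V : Fin 11 → GCA minkDeg, ∀ x, V x = bilin (mink x • Gam x) :=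
    ⟨_, fun _ => rfl⟩
  have hd (x y z u w : Fin 11) :
      superMink.d (B x y z u w * (vielb x * (vielb y * (vielb z * (vielb u * vielb w))))) =
        V x * B x y z u w * vielb4 y z u w - V y * B x y z u w * vielb4 x z u w
        + V z * B x y z u w * vielb4 x y u w - V u * B x y z u w * vielb4 x y z w
        + V w * B x y z u w * vielb4 x y z u := by
    rw [hB, d_bilin_mul]
    simp only [d_vielb_mul, d_vielb, hV, vielb4, mul_sub, vielb_mul_bilin_mul,
      ← bilin_comm _ (vielb u)]
    simp only [mul_assoc, bilin_mul_swap (Gam x * (Gam y * (Gam z * (Gam u * Gam w))))]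
    abel
  have key (x p q r s : Fin 11) :
      V x * B p x q r s * vielb4 p q r s = -(V x * B x p q r s * vielb4 p q r s) ∧
      V x * B p q x r s * vielb4 p q r s = V x * B x p q r s * vielb4 p q r s ∧
      V x * B p q r x s * vielb4 p q r s = -(V x * B x p q r s * vielb4 p q r s) ∧
      V x * B p q r s x * vielb4 p q r s = V x * B x p q r s * vielb4 p q r s := by
    rcases vielb4_eq_zero_or p q r s with h | h
    · simp [h]
    · simp only [hB, bilin_insert_one h, bilin_insert_two h, bilin_insert_three h,
        bilin_insert_four h, mul_neg, neg_mul, and_self]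
  have t1 : ∑ x, ∑ y, ∑ z, ∑ u, ∑ w, V x * B x y z u w * vielb4 y z u w
      = ∑ p, ∑ q, ∑ r, ∑ s, ∑ x, V x * B x p q r s * vielb4 p q r s := sum_comm_five _
  have t2 : ∑ x, ∑ y, ∑ z, ∑ u, ∑ w, V y * B x y z u w * vielb4 x z u w
      = -∑ p, ∑ q, ∑ r, ∑ s, ∑ x, V x * B x p q r s * vielb4 p q r s := by
    simp only [← Finset.sum_neg_distrib]
    refine Finset.sum_congr rfl fun p _ => ?_
    rw [sum_comm_four]
    simp only [(key _ _ _ _ _).1]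
  have t3 : ∑ x, ∑ y, ∑ z, ∑ u, ∑ w, V z * B x y z u w * vielb4 x y u w
      = ∑ p, ∑ q, ∑ r, ∑ s, ∑ x, V x * B x p q r s * vielb4 p q r s := by
    refine Finset.sum_congr rfl fun p _ => Finset.sum_congr rfl fun q _ => ?_
    rw [sum_comm_three]
    exact Finset.sum_congr rfl fun r _ => Finset.sum_congr rfl fun s _ =>
      Finset.sum_congr rfl fun x _ => (key x p q r s).2.1
  have t4 : ∑ x, ∑ y, ∑ z, ∑ u, ∑ w, V u * B x y z u w * vielb4 x y z w
      = -∑ p, ∑ q, ∑ r, ∑ s, ∑ x, V x * B x p q r s * vielb4 p q r s := by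
    simp only [← Finset.sum_neg_distrib]
    refine Finset.sum_congr rfl fun p _ => Finset.sum_congr rfl fun q _ =>
      Finset.sum_congr rfl fun r _ => ?_
    rw [Finset.sum_comm]
    simp only [(key _ _ _ _ _).2.2.1]
  have t5 : ∑ x, ∑ y, ∑ z, ∑ u, ∑ w, V w * B x y z u w * vielb4 x y z u
      = ∑ p, ∑ q, ∑ r, ∑ s, ∑ x, V x * B x p q r s * vielb4 p q r s := by
    exact Finset.sum_congr rfl fun p _ => Finset.sum_congr rfl fun q _ =>
      Finset.sum_congr rfl fun r _ => Finset.sum_congr rfl fun s _ =>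
        Finset.sum_congr rfl fun x _ => (key x p q r s).2.2.2
  rw [G7_eq]
  simp only [← hB, ← hV, map_smul, map_sum, hd]
  simp only [Finset.sum_add_distrib, Finset.sum_sub_distrib]
  rw [t1, t2, t3, t4, t5]
  module

theorem G4_mul_G4 : G4 * G4 = (1 / 4 : ℝ) • ∑ p, ∑ q, ∑ r, ∑ s,
    bilin (Gam p * Gam q) * bilin (Gam r * Gam s) * vielb4 p q r s := by
  have h : (∑ x, ∑ y, bilin (Gam x * Gam y) * (vielb x * vielb y))
        * (∑ x, ∑ y, bilin (Gam x * Gam y) * (vielb x * vielb y)) =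
      ∑ p, ∑ q, ∑ r, ∑ s, bilin (Gam p * Gam q) * bilin (Gam r * Gam s) * vielb4 p q r s := by
    rw [Finset.sum_mul]
    refine Finset.sum_congr rfl fun p _ => ?_
    rw [Finset.sum_mul]
    refine Finset.sum_congr rfl fun q _ => ?_
    rw [Finset.mul_sum]
    refine Finset.sum_congr rfl fun r _ => ?_
    rw [Finset.mul_sum]
    refine Finset.sum_congr rfl fun s _ => ?_
    simp only [vielb4, mul_assoc, vielb_mul_bilin_mul]
  rw [G4_eq, smul_mul_smul_comm, h]
  norm_num

/-- `d G₇ = (1/2) G₄ G₄`. -/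
theorem d_G7 : superMink.d G7 = (1 / 2 : ℝ) • (G4 * G4) := by
  obtain ⟨B, hB⟩ : ∃ B : Fin 11 → Fin 11 → GCA minkDeg, ∀ x y, B x y = bilin (Gam x * Gam y) :=
    ⟨_, fun _ _ => rfl⟩
  have h (p q r s : Fin 11) : ∑ x, bilin (mink x • Gam x)
        * bilin (Gam x * (Gam p * (Gam q * (Gam r * Gam s)))) * vielb4 p q r s =
      B p q * B r s * vielb4 p q r s - B p r * B q s * vielb4 p q r s
        + B p s * B q r * vielb4 p q r s := by
    rcases vielb4_eq_zero_or p q r s with h | h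
    · simp [h]
    · rw [← Finset.sum_mul, sum_bilin_Gam_mul_five p h.2.1.1 h.2.1.2 h.2.2, add_mul, sub_mul]
      simp only [hB]
  -- Against the antisymmetric `e^p e^q e^r e^s` the three pairings of the indices agree up to a
  -- sign matching that of the Fierz identity. They add up to three times the first, and `3/24 =
  -- (1/2)(1/4)`.
  have t2 : ∑ p, ∑ q, ∑ r, ∑ s, B p r * B q s * vielb4 p q r s
      = -∑ p, ∑ q, ∑ r, ∑ s, B p q * B r s * vielb4 p q r s := by
    simp only [← Finset.sum_neg_distrib]
    refine Finset.sum_congr rfl fun p _ => ?_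
    rw [Finset.sum_comm]
    refine Finset.sum_congr rfl fun q _ => Finset.sum_congr rfl fun r _ =>
      Finset.sum_congr rfl fun s _ => ?_
    rw [vielb4, vielb_swap_mul r q, vielb4]
    simp only [mul_neg]
  have t3 : ∑ p, ∑ q, ∑ r, ∑ s, B p s * B q r * vielb4 p q r s
      = ∑ p, ∑ q, ∑ r, ∑ s, B p q * B r s * vielb4 p q r s := by
    refine Finset.sum_congr rfl fun p _ => ?_
    rw [← sum_comm_three fun s q r => B p s * B q r * vielb4 p q r s]
    refine Finset.sum_congr rfl fun q _ => Finset.sum_congr rfl fun r _ =>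
      Finset.sum_congr rfl fun s _ => ?_
    rw [vielb4, vielb_swap s q, mul_neg, vielb_swap_mul r q, neg_neg, vielb4]
  rw [d_G7_eq_sum, G4_mul_G4]
  simp only [h, ← hB, Finset.sum_add_distrib, Finset.sum_sub_distrib]
  rw [t2, t3]
  module

/-! ### The M2-brane as a duality datum -/

theorem G7_mem : G7 ∈ superMink.homog (2 * 3 + 1, 0) := by
  refine Submodule.smul_mem _ _ (Submodule.sum_mem _ fun a _ => ?_)
  have h := mul_homog (bilin_mem (GamSkew a)) (mul_homog (vielb_mem (a 0))
    (mul_homog (vielb_mem (a 1)) (mul_homog (vielb_mem (a 2))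
      (mul_homog (vielb_mem (a 3)) (vielb_mem (a 4))))))
  have e : ((2, 0) : BiDeg) + ((1, 0) + ((1, 0) + ((1, 0) + ((1, 0) + (1, 0)))))
      = (2 * 3 + 1, 0) := by decide
  rw [e] at h
  simpa [List.ofFn_succ] using h

/-- The factor 2 in the Page charge compensates the `1/2` in `d_G7`: `d (2 G₇) = G₄ G₄ = -(G₄
(-G₄))`. -/
theorem isDualityDatum_G4 : IsDualityDatum superMink G4 (-G4) ((2 : ℝ) • G7) where
  isSuperLInfty := superMink_isSuperLInfty
  mem := G4_mem
  mem' := neg_G4_mem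
  mem_K := Submodule.smul_mem _ _ G7_mem
  d_eq := d_G4
  d_eq' := by rw [map_neg, d_G4, neg_zero]
  d_K := by rw [map_smul, d_G7, smul_smul, mul_neg, neg_neg]; norm_num

theorem pageCharge_eq : pageCharge = extTwist superMink ((2 : ℝ) • G7) (-G4) := by
  rw [pageCharge, extTwist, map_neg, mul_neg, ← sub_eq_add_neg, map_smul, two_smul, two_mul]

theorem pageChargeMinus_eq : pageChargeMinus = extTwist superMink ((2 : ℝ) • G7) G4 := by
  rw [pageChargeMinus, extTwist, map_smul, two_smul, two_mul]

/-! ### Non-closed elements -/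

/-- The evaluation `ψ^α ↦ 1`, `e^a ↦ 0`. -/
def evalOne : GCA minkDeg →ₐ[ℝ] ℝ :=
  GCA.lift (fun | .psi _ => 1 | .e _ => 0) (by
    rintro (α | a) (β | b) <;> simp [koszul, minkDeg, ZMod.val_one])

theorem evalOne_psi (α : SpinorIdx) : evalOne (psi α) = 1 := lift_gen _ _ _

/-- The spinor metric times `Γ^0` is the identity matrix, so this bilinear is the sum of the squares
of all 32 spinor components. -/
theorem evalOne_bilin_Gam_zero : evalOne (bilin (mink 0 • Gam 0)) = 32 := by
  have h : spinorMetric * (mink 0 • Gam 0) = 1 := by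
    rw [mul_smul_comm]
    change mink 0 • (spinorMetric * spinorMetric) = 1
    rw [spinorMetric_sq]
    simp [mink]
  rw [bilin, h]
  simp only [map_sum, map_smul, map_mul, evalOne_psi, Matrix.one_apply]
  simp

/-- The witness is `(ψ ψ)^n e^0` for one component `ψ`, squared so that its super-degree is even.
Its differential `(ψ ψ)^n (ψ̄ Γ^0 ψ)` evaluates to 32 when all spinor components are set to 1. -/
theorem exists_d_ne_zero_superMink (n : ℕ) :
    ∃ z ∈ superMink.homog (2 * n + 1, 0), superMink.d z ≠ 0 := by
  have hα : psi 0 * psi 0 ∈ superMink.homog (2, 0) := by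
    have h := mul_homog (gen_mem (deg := minkDeg) (.psi 0)) (gen_mem (deg := minkDeg) (.psi 0))
    have e : minkDeg (.psi 0) + minkDeg (.psi 0) = (2, 0) := by simp only [minkDeg]; decide
    rwa [e] at h
  have hd : superMink.d (psi 0 * psi 0) = 0 := by
    rw [d_mul, d_psi, zero_mul, mul_zero, add_zero]
  have hp : (psi 0 * psi 0) ^ n ∈ superMink.homog (2 * n, 0) ∧
      superMink.d ((psi 0 * psi 0) ^ n) = 0 := by
    induction n with
    | zero => simpa using ⟨one_homog, d_one (g := superMink)⟩
    | succ n ih =>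
      refine ⟨?_, ?_⟩
      · have := mul_homog ih.1 hα
        rw [Prod.mk_add_mk, add_zero] at this
        rw [pow_succ, Nat.cast_succ, mul_add, mul_one]
        exact this
      · rw [pow_succ, d_mul, ih.2, hd, zero_mul, mul_zero, add_zero]
  have hm := mul_homog hp.1 (vielb_mem 0)
  rw [Prod.mk_add_mk, add_zero] at hm
  refine ⟨(psi 0 * psi 0) ^ n * vielb 0, hm, fun h => ?_⟩
  rw [d_mul_even (g := superMink) (even_two_mul _) hp.1, hp.2, zero_mul, zero_add, d_vielb] at h
  have := congrArg evalOne h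
  rw [map_mul, map_pow, map_mul, evalOne_psi, evalOne_bilin_Gam_zero, map_zero] at this
  norm_num at this

end SuperLInfty

end

/-! ### Assembly for the M2-brane and its reflected copy -/

theorem mainTheorem9 :
    -- `m2brane` and its reflected copy are super-`L_∞` algebras
    m2brane.IsSuperLInfty ∧ m2braneMinus.IsSuperLInfty ∧
    -- the Page charges are 7-cocycles, related by higher T-duality
    (∃ (H : Hom m2brane (lineAlg 6)) (H' : Hom m2braneMinus (lineAlg 6)),
      H.pull (lineGen 6) = pageCharge ∧ H'.pull (lineGen 6) = pageChargeMinus ∧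
      TwistsTDual H H' ∧ TwistsTDual H' H) ∧
    -- the reflection isomorphism, which exchanges the Page charges
    ∃ (ρ : Hom m2brane m2braneMinus) (ρ' : Hom m2braneMinus m2brane),
      ρ.pull.comp ρ'.pull = AlgHom.id ℝ m2brane.CE ∧
      ρ'.pull.comp ρ.pull = AlgHom.id ℝ m2braneMinus.CE ∧
      ρ.pull c3Minus = -c3 ∧ (∀ x, ρ.pull (pullPMinus x) = pullP x) ∧
      ρ.pull pageChargeMinus = pageCharge ∧
      ∀ m : ℤ,
        -- higher T-duality of twisted cocycles from `m2brane` to its reflected copy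
        (∃ T : TwistedCocycle m2brane pageCharge m ≃
            TwistedCocycle m2braneMinus pageChargeMinus (m - 3),
          (∀ F, CocyclesTDual F (T F)) ∧
          (∀ F k, (T F).comp k =
            - pullPMinus (fibP (F.comp k)) - c3Minus * pullPMinus (basP (F.comp (k - 1)))) ∧
          (∀ F' k, (T.symm F').comp k =
            - pullP (fibPMinus (F'.comp (k + 1))) - c3 * pullP (basPMinus (F'.comp k))) ∧
          -- the self-duality on `m2brane` obtained by pullback along the reflection
          ∃ S : TwistedCocycle m2brane pageCharge m ≃ TwistedCocycle m2brane pageCharge (m - 3),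
            (∀ F, (S F).1.pull = ρ.pull.comp (T F).1.pull) ∧
            (∀ F k, (S F).comp k =
              - pullP (fibP (F.comp k)) + c3 * pullP (basP (F.comp (k - 1)))) ∧
            ∃ F k, ∀ (j : ℤ) (c : ℝ), (S F).comp k ≠ c • F.comp j) ∧
        -- and vice versa
        (∃ T : TwistedCocycle m2braneMinus pageChargeMinus m ≃
            TwistedCocycle m2brane pageCharge (m - 3),
          (∀ F, CocyclesTDual F (T F)) ∧
          (∀ F k, (T F).comp k =
            - pullP (fibPMinus (F.comp k)) - c3 * pullP (basPMinus (F.comp (k - 1)))) ∧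
          (∀ F' k, (T.symm F').comp k =
            - pullPMinus (fibP (F'.comp (k + 1))) - c3Minus * pullPMinus (basP (F'.comp k))) ∧
          ∃ S : TwistedCocycle m2braneMinus pageChargeMinus m ≃
              TwistedCocycle m2braneMinus pageChargeMinus (m - 3),
            (∀ F, (S F).1.pull = ρ'.pull.comp (T F).1.pull) ∧
            (∀ F k, (S F).comp k =
              - pullPMinus (fibPMinus (F.comp k))
                + c3Minus * pullPMinus (basPMinus (F.comp (k - 1)))) ∧
            ∃ F k, ∀ (j : ℤ) (c : ℝ), (S F).comp k ≠ c • F.comp j) := by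
  have D := isDualityDatum_G4
  -- The opposite direction applies the same results to `D.symm`, whose reflection needs its second
  -- class `G4` written as the negative of its first class `-G4`.
  have h' : G4 = -(-G4) := (neg_neg _).symm
  rw [pageCharge_eq, pageChargeMinus_eq]
  refine ⟨D.ext_isSuperLInfty, D.symm.ext_isSuperLInfty, ?_, reflection D.mem D.mem' rfl,
    reflection D.mem' D.mem h', map_reflVal_comp_self, map_reflVal_comp_self,
    map_reflVal_gen_none, map_reflVal_basicIncl, D.reflection_extTwist rfl, fun m => ⟨?_, ?_⟩⟩
  · obtain ⟨H, hH⟩ := D.exists_hom_extTwist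
    obtain ⟨H', hH'⟩ := D.symm.exists_hom_extTwist
    exact ⟨H, H', hH, hH', D.twistsTDual hH hH', D.symm.twistsTDual hH' hH⟩
  · exact ⟨D.dualEquiv m, D.cocyclesTDual m, D.dualEquiv_comp m, D.dualEquiv_symm_comp m,
      D.selfDualEquiv rfl m, fun _ => rfl, D.selfDualEquiv_comp rfl m,
      D.selfDualEquiv_nontrivial rfl exists_d_ne_zero_superMink m⟩
  · exact ⟨D.symm.dualEquiv m, D.symm.cocyclesTDual m, D.symm.dualEquiv_comp m,
      D.symm.dualEquiv_symm_comp m, D.symm.selfDualEquiv h' m, fun _ => rfl,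
      D.symm.selfDualEquiv_comp h' m,
      D.symm.selfDualEquiv_nontrivial h' exists_d_ne_zero_superMink m⟩
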